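/- Let $d\ge 0$ and identify each tangent space $T_W GL(d)$ with the space $\mathbb M_d$ of real $d\times d$ matrices. For an integer $N\ge 1$ and $W\in GL(d)$ define linear operators on $\mathbb M_d$ by $$\mathcal A_{N,W}(Z)=\frac1N\sum_{j=1}^N (WW^T)^{\frac{N-j}{N}}\,Z\,(W^TW)^{\frac{j-1}{N}},\qquad \mathcal A_{\infty,W}(Z)=\int_0^1 (WW^T)^{1-\tau}\,Z\,(W^TW)^{\tau}\,d\tau ,$$ and let $g^N$, $g^\infty$ be the metrics on $GL(d)$ given by $g^N_W(Z_1,Z_2)=\operatorname{tr}\big(\mathcal A_{N,W}^{-1}(Z_1)^T Z_2\big)$ for $1\le N\le\infty$. Write $dW$ for Lebesgue measure on $\mathbb M_d\cong\mathbb R^{d^2}$, and $\sqrt{\det g}\,dW$ for the Riemannian volume of a metric $g$ (taken positive). Use SVD coordinates $W=U\Sigma V^T$, with $U,V\in O(d)$ and $\Sigma=\operatorname{diag}(\sigma_1,\dots,\sigma_d)$, $\sigma_1\ge\dots\ge\sigma_d>0$. Let $d\Sigma=d\sigma_1\cdots d\sigma_d$ be Lebesgue measure on $\mathbb R^d$,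 let $dU$ and $dV$ be Haar measure on $O(d)$, normalized as the measure of the invariant volume form $\bigwedge_{i<j}(U^TdU)_{ij}$ (such a Haar measure exists; it is the one that agrees at the identity, to leading order, with Lebesgue measure in the exponential coordinates $(a_{ij})_{i<j}\mapsto \exp(A)$, $A^T=-A$, $A_{ij}=a_{ij}$ for $i<j$), and let $\mathrm{van}(\Lambda)=\prod_{i<j}(\Lambda_{ii}-\Lambda_{jj})$ for diagonal $\Lambda$. Then $$\sqrt{\det g^N}\,dW=N^{\frac{d(d-1)}2}\det(\Sigma^2)^{\frac{1-N}{2N}}\,\mathrm{van}\big(\Sigma^{2/N}\big)\,d\Sigma\,dU\,dV\qquad(1\le N<\infty),$$ $$\sqrt{\det g^\infty}\,dW=\frac{\mathrm{van}(\log\Sigma^2)}{\sqrt{\det(\Sigma^2)}}\,d\Sigma\,dU\,dV .$$ These identities hold both (i) pointwise: at every $(U,\Sigma,V)$, the pullback of the Riemannian volume form by $(U,\Sigma,V)\mapsto U\Sigma V^T$, evaluated in absolute value on the frame dual to the one-forms $(U^TdU)_{ij}$ $(i<j)$, $d\sigma_i$, $(V^TdV)_{ij}$ $(i<j)$, equals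 the stated density; and (ii) as measures: for every Borel set $S$ of triples $(U,\Sigma,V)$ on which $(U,\Sigma,V)\mapsto U\Sigma V^T$ is injective, the Riemannian volume of $\{U\Sigma V^T:(U,\Sigma,V)\in S\}$ is the integral over $S$ of the right-hand side. -/

import Mathlib

open MeasureTheory Filter Topology

noncomputable section

namespace DLN

/-- The space of real `d × d` matrices. -/
abbrev Mat (d : ℕ) : Type := Matrix (Fin d) (Fin d) ℝ

/-- The orthogonal group `O(d)`. -/
abbrev OGroup (d : ℕ) : Type := Matrix.orthogonalGroup (Fin d) ℝ

/-- Lebesgue measure `dW` on matrices: the product of the Lebesgue measures of the entries.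
(The subspace Borel structure on `OGroup d` is inherited from this one.) -/
instance instMeasureSpaceMat (d : ℕ) : MeasureSpace (Mat d) :=
  inferInstanceAs (MeasureSpace (Fin d → Fin d → ℝ))

/-! ### The metrics -/

/-- Real power `P ^ s` of a (symmetric positive definite) matrix, by functional calculus. -/
def matPow {d : ℕ} (P : Mat d) (s : ℝ) : Mat d := cfc (fun t : ℝ => t ^ s) P

/-- `𝒜_{N,W}(Z) = (1/N) ∑_{j=1}^N (W Wᵀ)^((N-j)/N) Z (Wᵀ W)^((j-1)/N)`. -/
def opA {d : ℕ} (N : ℕ) (W Z : Mat d) : Mat d :=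
  (1 / (N : ℝ)) • ∑ j ∈ Finset.Icc 1 N,
    matPow (W * W.transpose) (((N : ℝ) - (j : ℝ)) / (N : ℝ)) * Z *
      matPow (W.transpose * W) (((j : ℝ) - 1) / (N : ℝ))

/-- `𝒜_{∞,W}(Z) = ∫_0^1 (W Wᵀ)^(1-τ) Z (Wᵀ W)^τ dτ` (the integral is taken entrywise). -/
def opAInf {d : ℕ} (W Z : Mat d) : Mat d :=
  Matrix.of fun i j => ∫ τ in (0 : ℝ)..1,
    (matPow (W * W.transpose) (1 - τ) * Z * matPow (W.transpose * W) τ) i j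

/-- The bilinear form `(Z₁, Z₂) ↦ tr ((A⁻¹ Z₁)ᵀ Z₂)` of an operator `A` on matrices. -/
def formOf {d : ℕ} (A : Mat d → Mat d) (Z₁ Z₂ : Mat d) : ℝ :=
  ((Function.invFun A Z₁).transpose * Z₂).trace

/-- The metric `g^N` of depth `N`, at `W ∈ GL(d)`. -/
def metric {d : ℕ} (N : ℕ) (W : Mat d) : Mat d → Mat d → ℝ := formOf (opA N W)

/-- The metric `g^∞` of infinite depth, at `W ∈ GL(d)`. -/
def metricInf {d : ℕ} (W : Mat d) : Mat d → Mat d → ℝ := formOf (opAInf W)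

/-! ### Riemannian volume -/

/-- The value `√(det (g_W (e_a, e_b)))` of the Riemannian volume form of `g` at `W` (in absolute
value) on a tuple `e` of tangent vectors. -/
def volumeOn {d : ℕ} (g : Mat d → Mat d → Mat d → ℝ) (W : Mat d)
    {ι : Type} [Fintype ι] [DecidableEq ι] (e : ι → Mat d) : ℝ :=
  √ (Matrix.of fun a b => g W (e a) (e b)).det

/-- The Riemannian volume measure `√(det g) dW` on `GL(d)`, where `det g` is the determinant of
the matrix of `g` in the standard coordinates `w_{ij}`. -/
def volumeMeasure {d : ℕ} (g : Mat d → Mat d → Mat d → ℝ) : Measure (Mat d) :=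
  (volume.restrict {W : Mat d | IsUnit W.det}).withDensity fun W =>
    ENNReal.ofReal
      (volumeOn g W fun p : Fin d × Fin d => Matrix.single p.1 p.2 (1 : ℝ))

/-! ### SVD coordinates -/

/-- `(U, σ, V) ↦ U Σ Vᵀ` with `Σ = diag σ`. -/
def svdMap {d : ℕ} (x : Mat d × (Fin d → ℝ) × Mat d) : Mat d :=
  x.1 * Matrix.diagonal x.2.1 * x.2.2.transpose

/-- The positions `(i, j)` with `i < j`. -/
abbrev Pairs (d : ℕ) : Type := {p : Fin d × Fin d // p.1 < p.2}

/-- The skew-symmetric matrix with entries `a (i, j)` above the diagonal. -/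
def skew {d : ℕ} (a : Pairs d → ℝ) : Mat d :=
  Matrix.of fun i j =>
    if h : i < j then a ⟨(i, j), h⟩ else if h : j < i then -a ⟨(j, i), h⟩ else 0

/-- The frame of tangent vectors of `O(d) × ℝ^d × O(d)` at `(U, σ, V)` that is dual to the
coordinate one-forms `(Uᵀ dU)_{ij}`, `i < j`, then `dσ_i`, then `(Vᵀ dV)_{ij}`, `i < j`. -/
def svdFrame {d : ℕ} (U V : Mat d) :
    Pairs d ⊕ Fin d ⊕ Pairs d → Mat d × (Fin d → ℝ) × Mat d
  | .inl p => (U * skew (Pi.single p 1), 0, 0)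
  | .inr (.inl i) => (0, Pi.single i 1, 0)
  | .inr (.inr p) => (0, 0, V * skew (Pi.single p 1))

/-- The normalized Haar measure `dU` on `O(d)`: the Haar measure that is, at the identity,
Lebesgue measure in the exponential coordinates `a ↦ exp (skew a)`; that is, the measure of the
invariant volume form `⋀_{i<j} (Uᵀ dU)_{ij}`. -/
structure IsHaarO {d : ℕ} (μ : Measure (OGroup d)) : Prop where
  haar : μ.IsHaarMeasure
  unit_at_one : Tendsto (fun r : ℝ =>
    μ {U : OGroup d | ∃ a ∈ Metric.closedBall (0 : Pairs d → ℝ) r,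
        (U : Mat d) = NormedSpace.exp (skew a)}
      / volume (Metric.closedBall (0 : Pairs d → ℝ) r)) (𝓝[>] 0) (𝓝 1)

/-- Admissible singular values: positive and in decreasing order. -/
def IsSingVals {d : ℕ} (σ : Fin d → ℝ) : Prop := Antitone σ ∧ ∀ i, 0 < σ i

/-- The Vandermonde determinant `∏_{i<j} (Λ_i - Λ_j)` of `diag Λ`. -/
def van {d : ℕ} (Λ : Fin d → ℝ) : ℝ := ∏ i, ∏ j ∈ Finset.Ioi i, (Λ i - Λ j)

/-- The volume form of the metric `g` on `GL(d)` is `ρ(σ) dΣ dU dV` in SVD coordinates: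
pointwise, as a volume form on the frame dual to `dU`, `dΣ`, `dV` pushed forward by the derivative
of the SVD parametrization, and as a measure, on every Borel set of coordinates on which the
parametrization is injective, `dU` and `dV` being Haar measure and `dΣ` Lebesgue measure. -/
structure HasSVDVolumeForm {d : ℕ} (g : Mat d → Mat d → Mat d → ℝ)
    (ρ : (Fin d → ℝ) → ℝ) : Prop where
  pointwise : ∀ (U V : OGroup d) (σ : Fin d → ℝ), IsSingVals σ →
    volumeOn g (svdMap ((U : Mat d), σ, (V : Mat d)))
      (fun a => fderiv ℝ svdMap ((U : Mat d), σ, (V : Mat d)) (svdFrame (U : Mat d) (V : Mat d) a))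
      = ρ σ
  measure : ∀ μ : Measure (OGroup d), IsHaarO μ →
    ∀ S : Set (OGroup d × (Fin d → ℝ) × OGroup d), MeasurableSet S →
      (∀ x ∈ S, IsSingVals x.2.1) →
      Set.InjOn (fun x => svdMap ((x.1 : Mat d), x.2.1, (x.2.2 : Mat d))) S →
      volumeMeasure g ((fun x => svdMap ((x.1 : Mat d), x.2.1, (x.2.2 : Mat d))) '' S)
        = ∫⁻ x in S, ENNReal.ofReal (ρ x.2.1) ∂(μ.prod (volume.prod μ))

end DLN

end

/-! Write `W = U Σ Vᵀ`. In the basis `u_i v_jᵀ` of singular vectors, both operators are diagonal: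
they multiply the `(i, j)` coefficient by a positive number `Λ_ij`. Since `Z ↦ U Z Vᵀ` is an
isometry of the trace form, the Gram matrix of the metric in this basis is `diag (Λ_ij⁻¹)`. On the
other side, `Uᵀ dW V = (Uᵀ dU) Σ + dΣ - Σ (Vᵀ dV)`. This splits into the identity on `dΣ` and, for
each `i < j`, a 2 × 2 block of determinant `σ_j² - σ_i²`. The volume density is therefore `∏_{i<j}
|σ_i² - σ_j²| / √(Λ_ij Λ_ji)` times `∏_i Λ_ii^(-1/2)`. The decisive identity is `Λ_ij (f_i - f_j) =
σ_i² - σ_j²`, with `f = N σ^(2/N)` (a geometric sum) for depth `N` and `f = log σ²` (the fundamental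
theorem of calculus) for infinite depth. It turns the product over pairs into `van f`
(`volumeOn_svdFrame`).

The statement about measures follows from the pointwise one by a change of variables in exponential
charts. This needs the density of Haar measure there. A left invariant measure on `O(d)` is obtained
from Lebesgue measure on matrices: the measure of `B` is the volume of all `Q R` with `Q ∈ B` and
`R` in a fixed box of triangular matrices. The Jacobian of `(a, y) ↦ exp (skew a) * R(y)` is a
product of a function of `a` and a function of `y`, so in exponential coordinates the density is a
constant times `expJac`, the Jacobian of `exp` in the left invariant frame (`qrMeasure_image_expO`).
Dividing by the constant gives `haarO`, and uniqueness of Haar measure identifies every `IsHaarO`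
measure with it. In a chart, the Jacobian of the SVD map is the pointwise one times two factors
`expJac`, which are exactly the densities of `dU` and `dV`. Finitely many charts cover, and
injectivity lets the pieces be added. -/

noncomputable section

namespace DLN

/-! ### Diagonalization in the basis of singular vectors -/

open Matrix in
theorem matPow_conj {d : ℕ} {U : Mat d} (hU : U.transpose * U = 1) (s : Fin d → ℝ) (r : ℝ) :
    matPow (U * diagonal s * U.transpose) r = U * diagonal (fun i => s i ^ r) * U.transpose := by
  have hU' : U * U.transpose = 1 := mul_eq_one_comm.mp hU
  -- The spectrum is finite, so a Lagrange interpolant may replace the power function; polynomials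
  -- commute with conjugation.
  obtain ⟨q, hq⟩ : ∃ q : Polynomial ℝ, ∀ i, q.eval (s i) = s i ^ r := by
    refine ⟨Lagrange.interpolate (Finset.univ.image s) id (fun t => t ^ r), fun i => ?_⟩
    exact Lagrange.eval_interpolate_at_node (v := id) (fun t : ℝ => t ^ r)
      Function.injective_id.injOn (Finset.mem_image_of_mem s (Finset.mem_univ i))
  let u : (Mat d)ˣ := ⟨U, U.transpose, hU', hU⟩
  have hspec : spectrum ℝ (U * diagonal s * U.transpose) = Set.range s := by
    rw [← spectrum_diagonal s]
    exact spectrum.units_conjugate (u := u)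
  have hsa : IsSelfAdjoint (U * diagonal s * U.transpose) := by
    rw [isSelfAdjoint_iff, star_eq_conjTranspose]
    simp [Matrix.mul_assoc, conjTranspose_eq_transpose_of_trivial]
  have hpow : ∀ n : ℕ, (U * diagonal s * U.transpose) ^ n
      = U * diagonal s ^ n * U.transpose := fun n => u.conj_pow (diagonal s) n
  rw [matPow, cfc_congr (g := q.eval) (by
    rw [hspec]; rintro _ ⟨i, rfl⟩; exact (hq i).symm), cfc_polynomial q _ hsa,
    Polynomial.aeval_eq_sum_range]
  have hterm : ∀ n, q.coeff n • (U * diagonal s * U.transpose) ^ n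
      = U * (q.coeff n • diagonal s ^ n) * U.transpose := fun n => by
    rw [hpow, mul_smul_comm, smul_mul_assoc]
  rw [Finset.sum_congr rfl fun n _ => hterm n, ← Finset.sum_mul, ← Finset.mul_sum]
  congr 2
  ext i j
  simp_rw [diagonal_pow, ← diagonal_smul]
  rw [Matrix.sum_apply]
  rcases eq_or_ne i j with rfl | h
  · simp [← hq, Polynomial.eval_eq_sum_range]
  · simp [h]

/-- If `A` multiplies the coefficients in the basis `u_i v_jᵀ` by `Λ i j ≠ 0`, then so does its
inverse by `(Λ i j)⁻¹`. -/
theorem invFun_conj {d : ℕ} {A : Mat d → Mat d} {U V Λ : Mat d}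
    (hU : U.transpose * U = 1) (hV : V.transpose * V = 1) (hΛ : ∀ i j, Λ i j ≠ 0)
    (hA : ∀ Z, A (U * Z * V.transpose)
      = U * Matrix.of (fun i j => Λ i j * Z i j) * V.transpose) (Z : Mat d) :
    Function.invFun A (U * Z * V.transpose)
      = U * Matrix.of (fun i j => (Λ i j)⁻¹ * Z i j) * V.transpose := by
  have hU' : U * U.transpose = 1 := mul_eq_one_comm.mp hU
  have hV' : V * V.transpose = 1 := mul_eq_one_comm.mp hV
  have hsurj : ∀ W : Mat d, U * (U.transpose * W * V) * V.transpose = W := fun W => by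
    calc _ = (U * U.transpose) * W * (V * V.transpose) := by simp only [Matrix.mul_assoc]
      _ = W := by rw [hU', hV', one_mul, mul_one]
  have hcancel : ∀ X Y : Mat d, U * X * V.transpose = U * Y * V.transpose → X = Y := by
    intro X Y h
    have hX : ∀ X : Mat d, U.transpose * (U * X * V.transpose) * V = X := fun X => by
      calc _ = (U.transpose * U) * X * (V.transpose * V) := by simp only [Matrix.mul_assoc]
        _ = X := by rw [hU, hV, one_mul, mul_one]
    rw [← hX X, h, hX]
  -- `Function.invFun` is a left inverse only for an injective map; here injectivity comes from `Λ i
  -- j ≠ 0`.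
  have hinj : Function.Injective A := by
    intro X Y h
    rw [← hsurj X, ← hsurj Y, hA, hA] at h
    rw [← hsurj X, ← hsurj Y]
    congr 2
    ext i j
    exact mul_left_cancel₀ (hΛ i j) (congrFun (congrFun (hcancel _ _ h) i) j)
  have : U * Z * V.transpose
      = A (U * Matrix.of (fun i j => (Λ i j)⁻¹ * Z i j) * V.transpose) := by
    rw [hA]
    congr 2
    ext i j
    simp [hΛ i j]
  rw [this, Function.leftInverse_invFun hinj]

/-- Orthogonality of `U` and `V` makes `Z ↦ U Z Vᵀ` an isometry of `tr (Xᵀ Y)`, so only the factors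
`(Λ i j)⁻¹` remain. -/
theorem formOf_conj {d : ℕ} {A : Mat d → Mat d} {U V Λ : Mat d}
    (hU : U.transpose * U = 1) (hV : V.transpose * V = 1) (hΛ : ∀ i j, Λ i j ≠ 0)
    (hA : ∀ Z, A (U * Z * V.transpose)
      = U * Matrix.of (fun i j => Λ i j * Z i j) * V.transpose) (X Y : Mat d) :
    formOf A (U * X * V.transpose) (U * Y * V.transpose)
      = ∑ i, ∑ j, (Λ i j)⁻¹ * X i j * Y i j := by
  rw [formOf, invFun_conj hU hV hΛ hA]
  set X' : Mat d := Matrix.of (fun i j => (Λ i j)⁻¹ * X i j)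
  have : (U * X' * V.transpose).transpose * (U * Y * V.transpose)
      = V * (X'.transpose * Y * V.transpose) := by
    calc _ = V * (X'.transpose * (U.transpose * U) * Y * V.transpose) := by
          simp only [Matrix.transpose_mul, Matrix.transpose_transpose, Matrix.mul_assoc]
      _ = _ := by rw [hU, mul_one]
  rw [this, Matrix.trace_mul_comm, Matrix.mul_assoc, hV, mul_one]
  simp only [Matrix.trace, Matrix.diag_apply, Matrix.mul_apply, Matrix.transpose_apply]
  rw [Finset.sum_comm]
  rfl

theorem svd_mul_transpose {d : ℕ} {U V : Mat d} (hV : V.transpose * V = 1) (σ : Fin d → ℝ) :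
    svdMap (U, σ, V) * (svdMap (U, σ, V)).transpose
      = U * Matrix.diagonal (fun i => σ i ^ 2) * U.transpose := by
  calc _ = U * (Matrix.diagonal σ * (V.transpose * V) * Matrix.diagonal σ) * U.transpose := by
        simp only [svdMap, Matrix.transpose_mul, Matrix.transpose_transpose, Matrix.mul_assoc,
          Matrix.diagonal_transpose]
    _ = _ := by
        rw [hV, mul_one, Matrix.diagonal_mul_diagonal]
        simp only [pow_two]

theorem svd_transpose_mul {d : ℕ} {U V : Mat d} (hU : U.transpose * U = 1) (σ : Fin d → ℝ) :
    (svdMap (U, σ, V)).transpose * svdMap (U, σ, V)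
      = V * Matrix.diagonal (fun i => σ i ^ 2) * V.transpose := by
  calc _ = V * (Matrix.diagonal σ * (U.transpose * U) * Matrix.diagonal σ) * V.transpose := by
        simp only [svdMap, Matrix.transpose_mul, Matrix.transpose_transpose, Matrix.mul_assoc,
          Matrix.diagonal_transpose]
    _ = _ := by
        rw [hU, mul_one, Matrix.diagonal_mul_diagonal]
        simp only [pow_two]

/-- The common shape of the summands of `𝒜_N` and of the integrand of `𝒜_∞`: the left power is
diagonal in the columns of `U`, the right one in those of `V`. -/
theorem matPow_sandwich {d : ℕ} {U V : Mat d} (hU : U.transpose * U = 1)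
    (hV : V.transpose * V = 1) (σ : Fin d → ℝ) (r s : ℝ) (Z : Mat d) :
    matPow (svdMap (U, σ, V) * (svdMap (U, σ, V)).transpose) r * (U * Z * V.transpose) *
      matPow ((svdMap (U, σ, V)).transpose * svdMap (U, σ, V)) s
      = U * Matrix.of (fun i j => ((σ i ^ 2) ^ r * (σ j ^ 2) ^ s) * Z i j) * V.transpose := by
  rw [svd_mul_transpose hV, svd_transpose_mul hU, matPow_conj hU, matPow_conj hV]
  calc _ = U * (Matrix.diagonal (fun i => (σ i ^ 2) ^ r) * (U.transpose * U) * Z *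
          (V.transpose * V) * Matrix.diagonal (fun i => (σ i ^ 2) ^ s)) * V.transpose := by
        simp only [Matrix.mul_assoc]
    _ = _ := by
        rw [hU, hV, mul_one, mul_one]
        congr 2
        ext i j
        simp [Matrix.diagonal_mul, Matrix.mul_diagonal]
        ring

/-! ### Eigenvalues of the two operators -/

/-- The eigenvalue of `𝒜_N` on `u vᵀ`, for singular vectors with singular values `x`, `y`. -/
def eigN (N : ℕ) (x y : ℝ) : ℝ :=
  (1 / (N : ℝ)) * ∑ k ∈ Finset.Icc 1 N,
    (x ^ 2) ^ (((N : ℝ) - (k : ℝ)) / (N : ℝ)) * (y ^ 2) ^ (((k : ℝ) - 1) / (N : ℝ))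

/-- The eigenvalue of `𝒜_∞` on `u vᵀ`, for singular vectors with singular values `x`, `y`. -/
def eigInf (x y : ℝ) : ℝ := ∫ τ in (0 : ℝ)..1, (x ^ 2) ^ (1 - τ) * (y ^ 2) ^ τ

theorem opA_svd {d : ℕ} (N : ℕ) {U V : Mat d} (hU : U.transpose * U = 1)
    (hV : V.transpose * V = 1) (σ : Fin d → ℝ) (Z : Mat d) :
    opA N (svdMap (U, σ, V)) (U * Z * V.transpose)
      = U * Matrix.of (fun i j => eigN N (σ i) (σ j) * Z i j) * V.transpose := by
  rw [opA, Finset.sum_congr rfl fun k _ => matPow_sandwich hU hV σ _ _ Z, ← Finset.sum_mul,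
    ← Finset.mul_sum, ← smul_mul_assoc, ← mul_smul_comm]
  congr 2
  ext i j
  simp [Matrix.sum_apply, eigN, Finset.sum_mul, mul_assoc]

theorem continuous_rpow_sandwich {x y : ℝ} (hx : 0 < x) (hy : 0 < y) :
    Continuous fun τ : ℝ => (x ^ 2) ^ (1 - τ) * (y ^ 2) ^ τ := by
  have hx' : x ^ 2 ≠ 0 := by positivity
  have hy' : y ^ 2 ≠ 0 := by positivity
  exact (Continuous.rpow continuous_const (by fun_prop) fun _ => Or.inl hx').mul
    (Continuous.rpow continuous_const (by fun_prop) fun _ => Or.inl hy')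

theorem opAInf_svd {d : ℕ} {U V : Mat d} (hU : U.transpose * U = 1)
    (hV : V.transpose * V = 1) {σ : Fin d → ℝ} (hσ : ∀ i, 0 < σ i) (Z : Mat d) :
    opAInf (svdMap (U, σ, V)) (U * Z * V.transpose)
      = U * Matrix.of (fun i j => eigInf (σ i) (σ j) * Z i j) * V.transpose := by
  ext i j
  have h : ∀ τ : ℝ, (matPow (svdMap (U, σ, V) * (svdMap (U, σ, V)).transpose) (1 - τ) *
      (U * Z * V.transpose) * matPow ((svdMap (U, σ, V)).transpose * svdMap (U, σ, V)) τ) i j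
      = ∑ k, ∑ l, U i l * ((σ l ^ 2) ^ (1 - τ) * (σ k ^ 2) ^ τ * Z l k) * V j k := fun τ => by
    rw [matPow_sandwich hU hV]
    simp only [Matrix.of_apply, Matrix.mul_apply, Finset.sum_mul, Matrix.transpose_apply]
  rw [opAInf, Matrix.of_apply, intervalIntegral.integral_congr fun τ _ => h τ]
  simp only [Matrix.of_apply, Matrix.mul_apply, Finset.sum_mul, Matrix.transpose_apply]
  have hc : ∀ k l, Continuous fun τ : ℝ =>
      U i l * ((σ l ^ 2) ^ (1 - τ) * (σ k ^ 2) ^ τ * Z l k) * V j k := fun k l =>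
    (((continuous_rpow_sandwich (hσ l) (hσ k)).mul continuous_const).const_mul _).mul
      continuous_const
  rw [intervalIntegral.integral_finsetSum fun k _ =>
    (continuous_finsetSum _ fun l _ => hc k l).intervalIntegrable _ _]
  refine Finset.sum_congr rfl fun k _ => ?_
  rw [intervalIntegral.integral_finsetSum fun l _ => (hc k l).intervalIntegrable _ _]
  refine Finset.sum_congr rfl fun l _ => ?_
  rw [intervalIntegral.integral_mul_const, intervalIntegral.integral_const_mul,
    intervalIntegral.integral_mul_const, eigInf]

theorem eigN_pos {N : ℕ} (hN : 1 ≤ N) {x y : ℝ} (hx : 0 < x) (hy : 0 < y) : 0 < eigN N x y := by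
  have : 0 < (N : ℝ) := by exact_mod_cast hN
  refine mul_pos (by positivity) (Finset.sum_pos (fun k _ => by positivity) ?_)
  exact ⟨1, by simp [hN]⟩

theorem eigInf_pos {x y : ℝ} (hx : 0 < x) (hy : 0 < y) : 0 < eigInf x y :=
  intervalIntegral.intervalIntegral_pos_of_pos
    ((continuous_rpow_sandwich hx hy).intervalIntegrable _ _) (fun τ => by positivity) one_pos

/-- With `a = x^(2/N)` and `b = y^(2/N)`, `N` times the eigenvalue is the geometric sum `∑ a^(N-1-i)
b^i`, whose product with `a - b` telescopes to `a^N - b^N`. No division by `a - b` occurs, so `x =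
y` is allowed. -/
theorem eigN_mul_sub {N : ℕ} (hN : 1 ≤ N) {x y : ℝ} (hx : 0 < x) (hy : 0 < y) :
    eigN N x y * ((N : ℝ) * x ^ (2 / (N : ℝ)) - (N : ℝ) * y ^ (2 / (N : ℝ)))
      = x ^ 2 - y ^ 2 := by
  have hN' : (N : ℝ) ≠ 0 := by positivity
  have key : ∀ z : ℝ, 0 < z → ∀ n : ℕ, (z ^ 2) ^ ((n : ℝ) / (N : ℝ))
      = (z ^ (2 / (N : ℝ))) ^ n := by
    intro z hz n
    rw [← Real.rpow_natCast, ← Real.rpow_natCast, ← Real.rpow_mul hz.le, ← Real.rpow_mul hz.le]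
    congr 1
    push_cast
    ring
  have hsum : ∑ k ∈ Finset.Icc 1 N,
      (x ^ 2) ^ (((N : ℝ) - (k : ℝ)) / (N : ℝ)) * (y ^ 2) ^ (((k : ℝ) - 1) / (N : ℝ))
      = ∑ i ∈ Finset.range N, (y ^ (2 / (N : ℝ))) ^ i * (x ^ (2 / (N : ℝ))) ^ (N - 1 - i) := by
    rw [← Finset.Ico_add_one_right_eq_Icc, Finset.sum_Ico_eq_sum_range, Nat.add_sub_cancel]
    refine Finset.sum_congr rfl fun i hi => ?_
    have hi := Finset.mem_range.mp hi
    rw [← key x hx, ← key y hy, mul_comm, Nat.cast_sub (by omega), Nat.cast_sub hN]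
    push_cast
    congr 3 <;> ring
  have hgeom := geom_sum₂_mul (y ^ (2 / (N : ℝ))) (x ^ (2 / (N : ℝ))) N
  have hpow : ∀ z : ℝ, 0 < z → (z ^ (2 / (N : ℝ))) ^ N = z ^ 2 := fun z hz => by
    rw [← key z hz, div_self hN', Real.rpow_one]
  rw [hpow x hx, hpow y hy, ← hsum] at hgeom
  rw [eigN, ← mul_sub]
  field_simp
  linarith

theorem eigN_self {N : ℕ} (hN : 1 ≤ N) {x : ℝ} (hx : 0 < x) :
    eigN N x x = (x ^ 2) ^ (((N : ℝ) - 1) / (N : ℝ)) := by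
  have hN' : (N : ℝ) ≠ 0 := by positivity
  have : ∀ k ∈ Finset.Icc 1 N, (x ^ 2) ^ (((N : ℝ) - (k : ℝ)) / (N : ℝ)) *
      (x ^ 2) ^ (((k : ℝ) - 1) / (N : ℝ)) = (x ^ 2) ^ (((N : ℝ) - 1) / (N : ℝ)) := fun k _ => by
    rw [← Real.rpow_add (by positivity)]
    congr 1
    ring
  rw [eigN, Finset.sum_congr rfl this]
  simp [hN']

/-- The integrand is an exponential in `τ`: its derivative is itself times `log (y²) - log (x²)`,
and its endpoint values are `x²` and `y²`. -/
theorem eigInf_mul_sub {x y : ℝ} (hx : 0 < x) (hy : 0 < y) :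
    eigInf x y * (Real.log (x ^ 2) - Real.log (y ^ 2)) = x ^ 2 - y ^ 2 := by
  have hx' : 0 < x ^ 2 := by positivity
  have hy' : 0 < y ^ 2 := by positivity
  have hder : ∀ τ ∈ Set.uIcc (0 : ℝ) 1, HasDerivAt (fun τ : ℝ => (x ^ 2) ^ (1 - τ) * (y ^ 2) ^ τ)
      ((x ^ 2) ^ (1 - τ) * (y ^ 2) ^ τ * (Real.log (y ^ 2) - Real.log (x ^ 2))) τ := by
    intro τ _
    have h1 := ((hasDerivAt_id τ).const_sub 1).const_rpow hx'
    have h2 := (hasDerivAt_id τ).const_rpow hy'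
    exact (h1.mul h2).congr_deriv (by simp only [id]; ring)
  have := intervalIntegral.integral_eq_sub_of_hasDerivAt hder
    (((continuous_rpow_sandwich hx hy).mul continuous_const).intervalIntegrable _ _)
  rw [intervalIntegral.integral_mul_const] at this
  simp only [sub_self, Real.rpow_zero, sub_zero, Real.rpow_one, one_mul, mul_one] at this
  rw [eigInf]
  linarith

theorem eigInf_self {x : ℝ} (hx : 0 < x) : eigInf x x = x ^ 2 := by
  have : ∀ τ : ℝ, (x ^ 2) ^ (1 - τ) * (x ^ 2) ^ τ = x ^ 2 := fun τ => by
    rw [← Real.rpow_add (by positivity)]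
    simp
  simp [eigInf, this]

/-! ### Coordinates on matrices and the derivative of the SVD map -/

/-- Coordinates: entries above, on, and below the diagonal. -/
abbrev Coord (d : ℕ) : Type := (Pairs d → ℝ) × (Fin d → ℝ) × (Pairs d → ℝ)

/-- The index type of the standard basis of `Coord d`. -/
abbrev Idx (d : ℕ) : Type := Pairs d ⊕ Fin d ⊕ Pairs d

/-- The position in the matrix belonging to an index. -/
def idxEquiv (d : ℕ) : Idx d ≃ Fin d × Fin d where
  toFun
    | .inl p => p.1
    | .inr (.inl i) => (i, i)
    | .inr (.inr p) => (p.1.2, p.1.1)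
  invFun q := if h : q.1 < q.2 then .inl ⟨q, h⟩
    else if h : q.2 < q.1 then .inr (.inr ⟨(q.2, q.1), h⟩) else .inr (.inl q.1)
  left_inv := by
    rintro (⟨⟨i, j⟩, h⟩ | i | ⟨⟨i, j⟩, h⟩)
    · simp [show i < j from h]
    · simp
    · simp [show i < j from h, (show i < j from h).not_gt]
  right_inv := by
    rintro ⟨i, j⟩
    rcases lt_trichotomy i j with h | rfl | h
    · simp [h]
    · simp
    · simp [h, h.not_gt]

/-- The matrix with given entries above, on, and below the diagonal. -/
def toMatₗ (d : ℕ) : Coord d ≃ₗ[ℝ] Mat d where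
  toFun x := Matrix.of fun i j => if h : i < j then x.1 ⟨(i, j), h⟩
    else if h : j < i then x.2.2 ⟨(j, i), h⟩ else x.2.1 i
  invFun Z := (fun p => Z p.1.1 p.1.2, fun i => Z i i, fun p => Z p.1.2 p.1.1)
  map_add' x y := by
    ext i j
    simp only [Matrix.of_apply, Matrix.add_apply]
    split_ifs <;> rfl
  map_smul' c x := by
    ext i j
    simp only [Matrix.of_apply, Matrix.smul_apply]
    split_ifs <;> rfl
  left_inv := by
    rintro ⟨a, s, b⟩
    refine Prod.ext (funext ?_) (Prod.ext (funext ?_) (funext ?_))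
    · rintro ⟨⟨i, j⟩, h⟩
      simp [show i < j from h]
    · intro i
      simp
    · rintro ⟨⟨i, j⟩, h⟩
      simp [show i < j from h, (show i < j from h).not_gt]
  right_inv Z := by
    ext i j
    rcases lt_trichotomy i j with h | rfl | h
    · simp [h]
    · simp
    · simp [h, h.not_gt]

theorem toMatₗ_apply {d : ℕ} (x : Coord d) (i j : Fin d) :
    toMatₗ d x i j = if h : i < j then x.1 ⟨(i, j), h⟩
      else if h : j < i then x.2.2 ⟨(j, i), h⟩ else x.2.1 i := rfl

/-- The standard basis of `Coord d`. -/
def coordBasis (d : ℕ) : Module.Basis (Idx d) ℝ (Coord d) :=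
  (Pi.basisFun ℝ (Pairs d)).prod ((Pi.basisFun ℝ (Fin d)).prod (Pi.basisFun ℝ (Pairs d)))

theorem coordBasis_inl {d : ℕ} (p : Pairs d) :
    coordBasis d (.inl p) = (Pi.single p 1, 0, 0) := by
  simp only [coordBasis, Module.Basis.prod_apply, Sum.elim_inl,
    Function.comp_apply, LinearMap.inl_apply, Pi.basisFun_apply]
  rfl

theorem coordBasis_inr_inl {d : ℕ} (i : Fin d) :
    coordBasis d (.inr (.inl i)) = (0, Pi.single i 1, 0) := by
  simp [coordBasis]

theorem coordBasis_inr_inr {d : ℕ} (p : Pairs d) :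
    coordBasis d (.inr (.inr p)) = (0, 0, Pi.single p 1) := by
  simp [coordBasis]

theorem toMatₗ_coordBasis {d : ℕ} (a : Idx d) :
    toMatₗ d (coordBasis d a) = Matrix.single (idxEquiv d a).1 (idxEquiv d a).2 1 := by
  ext i j
  rw [toMatₗ_apply, Matrix.single_apply]
  rcases a with (⟨⟨k, l⟩, h⟩ | k | ⟨⟨k, l⟩, h⟩)
  · have h : k < l := h
    simp only [coordBasis_inl, Pi.single_apply, idxEquiv, Equiv.coe_fn_mk, Subtype.mk.injEq,
      Prod.mk.injEq, Pi.zero_apply, dite_eq_ite]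
    split_ifs <;> first | rfl | grind
  · simp only [coordBasis_inr_inl, Pi.single_apply, idxEquiv, Equiv.coe_fn_mk,
      Pi.zero_apply, dite_eq_ite]
    split_ifs <;> first | rfl | grind
  · have h : k < l := h
    simp only [coordBasis_inr_inr, Pi.single_apply, idxEquiv, Equiv.coe_fn_mk, Subtype.mk.injEq,
      Prod.mk.injEq, Pi.zero_apply, dite_eq_ite]
    split_ifs <;> first | rfl | grind

/-- The Gram matrix becomes `Kᵀ G K`; after a square root this is the transformation rule of a
volume density. -/
theorem det_gram_comp {ι M : Type*} [Fintype ι] [DecidableEq ι] [AddCommGroup M] [Module ℝ M]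
    (b : Module.Basis ι ℝ M) (B : LinearMap.BilinForm ℝ M) (K : M →ₗ[ℝ] M) :
    (Matrix.of fun i j => B (K (b i)) (K (b j))).det
      = LinearMap.det K ^ 2 * (Matrix.of fun i j => B (b i) (b j)).det := by
  have h1 : (Matrix.of fun i j => B (K (b i)) (K (b j)))
      = LinearMap.BilinForm.toMatrix b (B.comp K K) := by
    ext i j
    simp [LinearMap.BilinForm.toMatrix_apply]
  have h2 : (Matrix.of fun i j => B (b i) (b j)) = LinearMap.BilinForm.toMatrix b B := by
    ext i j
    simp [LinearMap.BilinForm.toMatrix_apply]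
  rw [h1, h2, LinearMap.BilinForm.toMatrix_comp b b, Matrix.det_mul, Matrix.det_mul, Matrix.det_transpose,
    LinearMap.det_toMatrix]
  ring

/-- The derivative of the singular value decomposition in the frames `(Uᵀ dU, dσ, Vᵀ dV)` and
`Uᵀ dW V`. -/
def svdCoord {d : ℕ} (σ : Fin d → ℝ) : Coord d →ₗ[ℝ] Coord d where
  toFun x := (fun p => σ p.1.2 * x.1 p - σ p.1.1 * x.2.2 p, x.2.1,
    fun p => -σ p.1.1 * x.1 p + σ p.1.2 * x.2.2 p)
  map_add' x y := by
    refine Prod.ext (funext fun p => ?_) (Prod.ext rfl (funext fun p => ?_)) <;>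
    simp <;> ring
  map_smul' c x := by
    refine Prod.ext (funext fun p => ?_) (Prod.ext rfl (funext fun p => ?_)) <;>
    simp <;> ring

/-- Each pair `i < j` contributes the block with rows `(σ_j, -σ_i)` and `(-σ_i, σ_j)`. Instead of
permuting the basis into 2 × 2 blocks, the proof takes the Schur complement of the upper left block,
which is invertible since `σ > 0`. -/
theorem det_svdCoord {d : ℕ} {σ : Fin d → ℝ} (hσ : ∀ i, 0 < σ i) :
    LinearMap.det (svdCoord σ) = ∏ p : Pairs d, (σ p.1.2 ^ 2 - σ p.1.1 ^ 2) := by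
  have hite : ∀ (P : Prop) [Decidable P] (x : ℝ), (if P then -x else 0) = -if P then x else 0 := by
    intro P _ x
    split_ifs <;> simp
  have hM : LinearMap.toMatrix (coordBasis d) (coordBasis d) (svdCoord σ)
      = Matrix.fromBlocks (Matrix.diagonal fun p : Pairs d => σ p.1.2)
          (Matrix.fromCols 0 (Matrix.diagonal fun p => -σ p.1.1))
          (Matrix.fromRows 0 (Matrix.diagonal fun p => -σ p.1.1))
          (Matrix.fromBlocks 1 0 0 (Matrix.diagonal fun p : Pairs d => σ p.1.2)) := by
    ext a b
    rw [LinearMap.toMatrix_apply]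
    rcases b with q | j | q
    · rw [coordBasis_inl]
      rcases a with p | i | p <;>
      simp [coordBasis, svdCoord, Matrix.diagonal_apply, Pi.single_apply, eq_comm, hite]
    · rw [coordBasis_inr_inl]
      rcases a with p | i | p <;>
      simp [coordBasis, svdCoord, Matrix.one_apply, Pi.single_apply, eq_comm]
    · rw [coordBasis_inr_inr]
      rcases a with p | i | p <;>
      simp [coordBasis, svdCoord, Matrix.diagonal_apply, Pi.single_apply, eq_comm, hite]
  have hσ' : ∀ p : Pairs d, σ p.1.2 ≠ 0 := fun p => (hσ _).ne'
  let _ : Invertible (Matrix.diagonal fun p : Pairs d => σ p.1.2) :=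
    ⟨Matrix.diagonal fun p : Pairs d => (σ p.1.2)⁻¹, by simp [hσ'], by simp [hσ']⟩
  have hinv : ⅟ (Matrix.diagonal fun p : Pairs d => σ p.1.2)
      = Matrix.diagonal fun p : Pairs d => (σ p.1.2)⁻¹ := rfl
  have hschur : Matrix.fromBlocks (1 : Mat d) 0 0 (Matrix.diagonal fun p : Pairs d => σ p.1.2)
      - Matrix.fromRows (0 : Matrix (Fin d) (Pairs d) ℝ)
          (Matrix.diagonal fun p : Pairs d => -σ p.1.1) *
        (Matrix.diagonal fun p : Pairs d => (σ p.1.2)⁻¹) *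
        Matrix.fromCols (0 : Matrix (Pairs d) (Fin d) ℝ)
          (Matrix.diagonal fun p : Pairs d => -σ p.1.1)
      = Matrix.fromBlocks (1 : Mat d) 0 0 (Matrix.diagonal fun p : Pairs d =>
          σ p.1.2 - σ p.1.1 * (σ p.1.2)⁻¹ * σ p.1.1) := by
    rw [Matrix.fromRows_mul, Matrix.fromRows_mul_fromCols, sub_eq_add_neg, Matrix.fromBlocks_neg,
      Matrix.fromBlocks_add]
    simp [sub_eq_add_neg]
  rw [← LinearMap.det_toMatrix (coordBasis d), hM, Matrix.det_fromBlocks₁₁, hinv, hschur,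
    Matrix.det_fromBlocks_zero₂₁, Matrix.det_one, Matrix.det_diagonal, Matrix.det_diagonal,
    one_mul, ← Finset.prod_mul_distrib]
  refine Finset.prod_congr rfl fun p _ => ?_
  have := hσ' p
  field_simp

-- The operator norm makes matrices a normed algebra, which gives the product rule. The derivative
-- itself depends only on the topology, so later statements need no norm.
open scoped Matrix.Norms.Operator in
theorem hasFDerivAt_svdMap {d : ℕ} (x : Mat d × (Fin d → ℝ) × Mat d) :
    ∃ D : Mat d × (Fin d → ℝ) × Mat d →L[ℝ] Mat d, HasFDerivAt svdMap D x ∧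
      ∀ y, D y = y.1 * Matrix.diagonal x.2.1 * x.2.2.transpose
        + x.1 * Matrix.diagonal y.2.1 * x.2.2.transpose
        + x.1 * Matrix.diagonal x.2.1 * y.2.2.transpose := by
  let T : Mat d →L[ℝ] Mat d :=
    (Matrix.transposeLinearEquiv (Fin d) (Fin d) ℝ ℝ).toLinearMap.toContinuousLinearMap
  let Δ : (Fin d → ℝ) →L[ℝ] Mat d := (Matrix.diagonalLinearMap (Fin d) ℝ ℝ).toContinuousLinearMap
  let π₁ := ContinuousLinearMap.fst ℝ (Mat d) ((Fin d → ℝ) × Mat d)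
  let π₂ := (ContinuousLinearMap.fst ℝ (Fin d → ℝ) (Mat d)).comp
    (ContinuousLinearMap.snd ℝ (Mat d) ((Fin d → ℝ) × Mat d))
  let π₃ := (ContinuousLinearMap.snd ℝ (Fin d → ℝ) (Mat d)).comp
    (ContinuousLinearMap.snd ℝ (Mat d) ((Fin d → ℝ) × Mat d))
  have h1 := π₁.hasFDerivAt (x := x)
  have h2 := (Δ.comp π₂).hasFDerivAt (x := x)
  have h3 := (T.comp π₃).hasFDerivAt (x := x)
  refine ⟨_, (h1.mul' h2).mul' h3, fun y => ?_⟩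
  change x.1 * Matrix.diagonal x.2.1 * y.2.2.transpose
    + (x.1 * Matrix.diagonal y.2.1 + y.1 * Matrix.diagonal x.2.1) * x.2.2.transpose = _
  rw [add_mul]
  abel

theorem fderiv_svdMap_apply {d : ℕ} (x y : Mat d × (Fin d → ℝ) × Mat d) :
    fderiv ℝ svdMap x y = y.1 * Matrix.diagonal x.2.1 * x.2.2.transpose
        + x.1 * Matrix.diagonal y.2.1 * x.2.2.transpose
        + x.1 * Matrix.diagonal x.2.1 * y.2.2.transpose := by
  obtain ⟨D, hD, h⟩ := hasFDerivAt_svdMap x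
  rw [← h, hD.fderiv]

theorem skew_transpose {d : ℕ} (a : Pairs d → ℝ) : (skew a).transpose = -skew a := by
  ext i j
  simp only [Matrix.transpose_apply, Matrix.neg_apply, skew, Matrix.of_apply]
  rcases lt_trichotomy i j with h | rfl | h
  · simp [h, h.not_gt]
  · simp
  · simp [h, h.not_gt]

/-- `skew` as a linear map. -/
def skewₗ (d : ℕ) : (Pairs d → ℝ) →ₗ[ℝ] Mat d where
  toFun := skew
  map_add' a b := by
    ext i j
    simp only [skew, Matrix.of_apply, Matrix.add_apply]
    split_ifs <;> simp [add_comm]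
  map_smul' c a := by
    ext i j
    simp only [skew, Matrix.of_apply, Matrix.smul_apply]
    split_ifs <;> simp

/-- The vector of `U (skew α), τ, V (skew β)` tangent to `O(d) × ℝ^d × O(d)` at `(U, σ, V)`. -/
def frameMap {d : ℕ} (U V : Mat d) : Coord d →ₗ[ℝ] Mat d × (Fin d → ℝ) × Mat d :=
  ((LinearMap.mulLeft ℝ U).comp (skewₗ d)).prodMap
    (LinearMap.id.prodMap ((LinearMap.mulLeft ℝ V).comp (skewₗ d)))

theorem frameMap_apply {d : ℕ} (U V : Mat d) (x : Coord d) :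
    frameMap U V x = (U * skew x.1, x.2.1, V * skew x.2.2) := rfl

theorem frameMap_coordBasis {d : ℕ} (U V : Mat d) (a : Idx d) :
    frameMap U V (coordBasis d a) = svdFrame U V a := by
  have h0 : skew (0 : Pairs d → ℝ) = 0 := map_zero (skewₗ d)
  rcases a with p | i | p
  · simp [coordBasis_inl, frameMap_apply, svdFrame, h0]
  · simp [coordBasis_inr_inl, frameMap_apply, svdFrame, h0]
  · simp [coordBasis_inr_inr, frameMap_apply, svdFrame, h0]

/-- This is `Uᵀ dW V = α Σ + dΣ - Σ β` with `α = Uᵀ dU`, `β = Vᵀ dV`; the minus sign is the skewness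
of `β`. -/
theorem fderiv_svdMap_frameMap {d : ℕ} (U V : Mat d) (σ : Fin d → ℝ) (x : Coord d) :
    fderiv ℝ svdMap (U, σ, V) (frameMap U V x)
      = U * toMatₗ d (svdCoord σ x) * V.transpose := by
  have : toMatₗ d (svdCoord σ x) = skew x.1 * Matrix.diagonal σ + Matrix.diagonal x.2.1
      - Matrix.diagonal σ * skew x.2.2 := by
    ext i j
    rw [toMatₗ_apply]
    simp only [svdCoord, LinearMap.coe_mk, AddHom.coe_mk, Matrix.sub_apply, Matrix.add_apply,
      Matrix.mul_diagonal, Matrix.diagonal_mul, skew, Matrix.of_apply, Matrix.diagonal_apply]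
    rcases lt_trichotomy i j with h | rfl | h
    · simp [h, h.ne]
      ring
    · simp
    · simp [h, h.not_gt, h.ne']
      ring
  rw [fderiv_svdMap_apply, frameMap_apply, this, Matrix.transpose_mul, skew_transpose]
  noncomm_ring

/-! ### The pointwise volume formula -/

/-- The bilinear form `∑ Λ_ij⁻¹ (Uᵀ X V)_ij (Uᵀ Y V)_ij`. -/
theorem exists_bilinForm {d : ℕ} {A : Mat d → Mat d} {U V Λ : Mat d}
    (hU : U.transpose * U = 1) (hV : V.transpose * V = 1) (hΛ : ∀ i j, Λ i j ≠ 0)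
    (hA : ∀ Z, A (U * Z * V.transpose)
      = U * Matrix.of (fun i j => Λ i j * Z i j) * V.transpose) :
    ∃ B : LinearMap.BilinForm ℝ (Mat d), ∀ X Y, formOf A X Y = B X Y := by
  have hU' : U * U.transpose = 1 := mul_eq_one_comm.mp hU
  have hV' : V * V.transpose = 1 := mul_eq_one_comm.mp hV
  have hsurj : ∀ W : Mat d, U * (U.transpose * W * V) * V.transpose = W := fun W => by
    calc _ = (U * U.transpose) * W * (V * V.transpose) := by simp only [Matrix.mul_assoc]
      _ = W := by rw [hU', hV', one_mul, mul_one]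
  have h : ∀ X Y, formOf A X Y = ∑ i, ∑ j, (Λ i j)⁻¹ * (U.transpose * X * V) i j *
      (U.transpose * Y * V) i j := fun X Y => by
    rw [← formOf_conj hU hV hΛ hA, hsurj, hsurj]
  refine ⟨LinearMap.mk₂ ℝ (formOf A) ?_ ?_ ?_ ?_, fun X Y => rfl⟩
  · intro X X' Y
    simp only [h, Matrix.add_apply, mul_add, add_mul,
      Finset.sum_add_distrib]
  · intro c X Y
    simp only [h, Matrix.mul_smul, Matrix.smul_mul, Matrix.smul_apply, smul_eq_mul,
      Finset.mul_sum]
    exact Finset.sum_congr rfl fun i _ => Finset.sum_congr rfl fun j _ => by ring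
  · intro X Y Y'
    simp only [h, Matrix.add_apply, mul_add, add_mul,
      Finset.sum_add_distrib]
  · intro c X Y
    simp only [h, Matrix.mul_smul, Matrix.smul_mul, Matrix.smul_apply, smul_eq_mul,
      Finset.mul_sum]
    exact Finset.sum_congr rfl fun i _ => Finset.sum_congr rfl fun j _ => by ring

theorem prod_idx {d : ℕ} (f : Fin d → Fin d → ℝ) :
    ∏ a : Idx d, f (idxEquiv d a).1 (idxEquiv d a).2
      = (∏ p : Pairs d, f p.1.1 p.1.2 * f p.1.2 p.1.1) * ∏ i, f i i := by
  rw [Fintype.prod_sum_type, Fintype.prod_sum_type, Finset.prod_mul_distrib, mul_assoc,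
    mul_comm (∏ p : Pairs d, f p.1.2 p.1.1)]
  rfl

theorem van_eq_prod_pairs {d : ℕ} (f : Fin d → ℝ) :
    van f = ∏ p : Pairs d, (f p.1.1 - f p.1.2) := by
  rw [van, Finset.prod_sigma']
  exact Finset.prod_bij' (fun x hx => ⟨(x.1, x.2), Finset.mem_Ioi.mp (Finset.mem_sigma.mp hx).2⟩)
    (fun p _ => ⟨p.1.1, p.1.2⟩) (fun _ _ => Finset.mem_univ _)
    (fun p _ => Finset.mem_sigma.mpr ⟨Finset.mem_univ _, Finset.mem_Ioi.mpr p.2⟩)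
    (fun _ _ => rfl) (fun _ _ => rfl) (fun _ _ => rfl)

theorem van_nonneg {d : ℕ} {f : Fin d → ℝ} (hf : Antitone f) : 0 ≤ van f :=
  Finset.prod_nonneg fun _ _ => Finset.prod_nonneg fun _ hj =>
    sub_nonneg.mpr (hf (Finset.mem_Ioi.mp hj).le)

/-- Source of the power of `N` in the density of finite depth, where `f` carries a factor `N`; the
exponent counts the pairs `i < j`. -/
theorem van_const_mul {d : ℕ} (c : ℝ) (f : Fin d → ℝ) :
    van (fun i => c * f i) = c ^ (d * (d - 1) / 2) * van f := by
  have : ∑ i : Fin d, (Finset.Ioi i).card = d * (d - 1) / 2 := by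
    simp_rw [Fin.card_Ioi]
    rw [Fin.sum_univ_eq_sum_range fun i => d - 1 - i, Finset.sum_range_reflect (fun i => i),
      Finset.sum_range_id]
  simp_rw [van, ← mul_sub, Finset.prod_mul_distrib, Finset.prod_const, Finset.prod_pow_eq_pow_sum,
    this]

/-- The volume of the frame dual to `(dU, dσ, dV)`, for a metric `tr (A⁻¹(X)ᵀ Y)` whose operator is
diagonal in the basis of singular vectors. -/
theorem volumeOn_svdFrame {d : ℕ} {g : Mat d → Mat d → Mat d → ℝ} {A : Mat d → Mat d}
    {U V Λ : Mat d} {σ f : Fin d → ℝ}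
    (hU : U.transpose * U = 1) (hV : V.transpose * V = 1) (hσ : ∀ i, 0 < σ i)
    (hg : g (svdMap (U, σ, V)) = formOf A) (hf : Antitone f)
    (hΛ : ∀ i j, 0 < Λ i j) (hΛf : ∀ i j, Λ i j * (f i - f j) = σ i ^ 2 - σ j ^ 2)
    (hA : ∀ Z, A (U * Z * V.transpose)
      = U * Matrix.of (fun i j => Λ i j * Z i j) * V.transpose) :
    volumeOn g (svdMap (U, σ, V)) (fun a => fderiv ℝ svdMap (U, σ, V) (svdFrame U V a))
      = van f / √ (∏ i, Λ i i) := by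
  have hΛ' := fun i j => (hΛ i j).ne'
  obtain ⟨B, hB⟩ := exists_bilinForm hU hV hΛ' hA
  let N : Coord d →ₗ[ℝ] Mat d :=
    (LinearMap.mulRight ℝ V.transpose).comp ((LinearMap.mulLeft ℝ U).comp (toMatₗ d).toLinearMap)
  have hN : ∀ x, N x = U * toMatₗ d x * V.transpose := fun x => rfl
  have hdiag : (Matrix.of fun a b => B.comp N N (coordBasis d a) (coordBasis d b))
      = Matrix.diagonal fun a => (Λ (idxEquiv d a).1 (idxEquiv d a).2)⁻¹ := by
    ext a b
    simp only [Matrix.of_apply, LinearMap.BilinForm.comp_apply, ← hB, hN,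
      formOf_conj hU hV hΛ' hA, toMatₗ_coordBasis]
    rw [Finset.sum_eq_single (idxEquiv d a).1 (fun i _ hi => Finset.sum_eq_zero fun j _ => by
        simp [Matrix.single_apply, hi.symm]) (by simp),
      Finset.sum_eq_single (idxEquiv d a).2 (fun j _ hj => by
        simp [Matrix.single_apply, hj.symm]) (by simp)]
    rcases eq_or_ne a b with rfl | hab
    · simp
    · have : ¬ ((idxEquiv d b).1 = (idxEquiv d a).1 ∧ (idxEquiv d b).2 = (idxEquiv d a).2) :=
        fun h => hab ((idxEquiv d).injective (Prod.ext h.1 h.2)).symm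
      simp [hab, this]
  have key : (Matrix.of fun a b => g (svdMap (U, σ, V))
      (fderiv ℝ svdMap (U, σ, V) (svdFrame U V a)) (fderiv ℝ svdMap (U, σ, V) (svdFrame U V b))).det
      = (van f / √ (∏ i, Λ i i)) ^ 2 := by
    have h1 : ∀ a b, g (svdMap (U, σ, V)) (fderiv ℝ svdMap (U, σ, V) (svdFrame U V a))
        (fderiv ℝ svdMap (U, σ, V) (svdFrame U V b))
        = B.comp N N (svdCoord σ (coordBasis d a)) (svdCoord σ (coordBasis d b)) := fun a b => by
      rw [hg, hB, ← frameMap_coordBasis, ← frameMap_coordBasis, fderiv_svdMap_frameMap,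
        fderiv_svdMap_frameMap]
      rfl
    simp only [h1]
    rw [det_gram_comp, hdiag, Matrix.det_diagonal, det_svdCoord hσ,
      prod_idx fun i j => (Λ i j)⁻¹, div_pow, Real.sq_sqrt (Finset.prod_nonneg fun i _ => (hΛ i i).le),
      van_eq_prod_pairs, ← mul_assoc, Finset.prod_inv_distrib, div_eq_mul_inv]
    congr 1
    rw [← Finset.prod_pow, ← Finset.prod_pow, ← Finset.prod_mul_distrib]
    refine Finset.prod_congr rfl fun p _ => ?_
    have e1 := hΛf p.1.1 p.1.2
    have e2 := hΛf p.1.2 p.1.1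
    have n1 := hΛ' p.1.1 p.1.2
    have n2 := hΛ' p.1.2 p.1.1
    -- The product of the identities for `(i, j)` and `(j, i)`. It also holds for equal singular
    -- values, where both sides vanish, and does not need `Λ` to be symmetric.
    have : (σ p.1.2 ^ 2 - σ p.1.1 ^ 2) ^ 2 = (Λ p.1.1 p.1.2 * Λ p.1.2 p.1.1) *
        (f p.1.1 - f p.1.2) ^ 2 := by
      linear_combination (-(Λ p.1.2 p.1.1 * (f p.1.1 - f p.1.2))) * e1
        + (σ p.1.1 ^ 2 - σ p.1.2 ^ 2) * e2
    rw [this]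
    field_simp
  rw [volumeOn, key, Real.sqrt_sq (div_nonneg (van_nonneg hf) (Real.sqrt_nonneg _))]

/-! ### Lebesgue measure on matrices and the topology of `O(d)` -/

instance instBorelSpaceMat (d : ℕ) : BorelSpace (Mat d) :=
  inferInstanceAs (BorelSpace (Fin d → Fin d → ℝ))

instance instPolishSpaceMat (d : ℕ) : PolishSpace (Mat d) :=
  inferInstanceAs (PolishSpace (Fin d → Fin d → ℝ))

instance instIsAddHaarMeasureMat (d : ℕ) : (volume : Measure (Mat d)).IsAddHaarMeasure :=
  Measure.pi.isAddHaarMeasure fun _ : Fin d => (volume : Measure (Fin d → ℝ))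

instance instIsAddHaarMeasureCoord (d : ℕ) : (volume : Measure (Coord d)).IsAddHaarMeasure :=
  have : ((volume : Measure (Fin d → ℝ)).prod
      (volume : Measure (Pairs d → ℝ))).IsAddHaarMeasure :=
    Measure.prod.instIsAddHaarMeasure _ _
  Measure.prod.instIsAddHaarMeasure (volume : Measure (Pairs d → ℝ))
    ((volume : Measure (Fin d → ℝ)).prod (volume : Measure (Pairs d → ℝ)))

instance instLocallyCompactSpaceMat (d : ℕ) : LocallyCompactSpace (Mat d) :=
  inferInstanceAs (LocallyCompactSpace (Fin d → Fin d → ℝ))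

theorem isClosed_orthogonalGroup (d : ℕ) :
    IsClosed (Matrix.orthogonalGroup (Fin d) ℝ : Set (Mat d)) := by
  have : (Matrix.orthogonalGroup (Fin d) ℝ : Set (Mat d))
      = {U : Mat d | U.transpose * U = 1} := by
    ext U
    exact Matrix.mem_orthogonalGroup_iff' (Fin d) ℝ
  rw [this]
  exact isClosed_eq (by fun_prop) continuous_const

theorem OGroup.transpose_mul {d : ℕ} (U : OGroup d) : (U : Mat d).transpose * (U : Mat d) = 1 :=
  (Matrix.mem_orthogonalGroup_iff' (Fin d) ℝ).mp U.2

theorem OGroup.mul_transpose {d : ℕ} (U : OGroup d) : (U : Mat d) * (U : Mat d).transpose = 1 :=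
  (Matrix.mem_orthogonalGroup_iff (Fin d) ℝ).mp U.2

instance instBorelSpaceOGroup (d : ℕ) : BorelSpace (OGroup d) :=
  inferInstanceAs (BorelSpace (Matrix.orthogonalGroup (Fin d) ℝ : Set (Mat d)))

instance instPolishSpaceOGroup (d : ℕ) : PolishSpace (OGroup d) :=
  (isClosed_orthogonalGroup d).polishSpace

instance instCompactSpaceOGroup (d : ℕ) : CompactSpace (OGroup d) := by
  have hK : IsCompact (Set.pi Set.univ fun _ : Fin d => Set.pi Set.univ fun _ : Fin d =>
      Set.Icc (-1 : ℝ) 1) := isCompact_univ_pi fun _ => isCompact_univ_pi fun _ => isCompact_Icc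
  refine isCompact_iff_compactSpace.mp
    (hK.of_isClosed_subset (isClosed_orthogonalGroup d) fun (U : Mat d) hU => ?_)
  intro i _ j _
  have h : ∑ k, U k j * U k j = 1 := by
    have := congrFun (congrFun ((Matrix.mem_orthogonalGroup_iff' (Fin d) ℝ).mp hU) j) j
    simpa only [Matrix.mul_apply, Matrix.transpose_apply, Matrix.one_apply_eq] using this
  have : U i j * U i j ≤ 1 :=
    h ▸ Finset.single_le_sum (f := fun k => U k j * U k j) (fun k _ => mul_self_nonneg _)
      (Finset.mem_univ i)
  exact ⟨by nlinarith, by nlinarith⟩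

/-- `toMatₗ` as a continuous linear equivalence. -/
def toMat (d : ℕ) : Coord d ≃L[ℝ] Mat d where
  toLinearEquiv := toMatₗ d
  continuous_toFun := (toMatₗ d).toLinearMap.continuous_of_finiteDimensional
  continuous_invFun := by
    change Continuous fun Z : Mat d => ((fun p : Pairs d => Z p.1.1 p.1.2, fun i => Z i i,
      fun p : Pairs d => Z p.1.2 p.1.1) : Coord d)
    fun_prop

/-- A linear isomorphism carries Lebesgue measure to a multiple of Lebesgue measure; the unit cube
shows that the factor is 1. -/
theorem measurePreserving_toMat (d : ℕ) : MeasurePreserving (toMat d) := by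
  refine ⟨(toMat d).continuous.measurable, ?_⟩
  let K : Set (Mat d) := Set.pi Set.univ fun _ : Fin d => Set.pi Set.univ fun _ : Fin d =>
      Set.Icc (0 : ℝ) 1
  have hK : (volume : Measure (Mat d)) K = 1 := by
    change (volume : Measure (Fin d → Fin d → ℝ)) K = 1
    simp only [K, volume_pi_pi, Real.volume_Icc]
    simp
  have hpre : toMat d ⁻¹' K = (Set.pi Set.univ fun _ => Set.Icc (0 : ℝ) 1) ×ˢ
      ((Set.pi Set.univ fun _ => Set.Icc (0 : ℝ) 1) ×ˢ
        (Set.pi Set.univ fun _ => Set.Icc (0 : ℝ) 1)) := by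
    ext x
    constructor
    · intro hx
      have hx : ∀ i j, toMatₗ d x i j ∈ Set.Icc (0 : ℝ) 1 := fun i j =>
        hx i (Set.mem_univ i) j (Set.mem_univ j)
      refine ⟨fun p _ => ?_, fun i _ => ?_, fun p _ => ?_⟩
      · have := hx p.1.1 p.1.2
        rwa [toMatₗ_apply, dif_pos p.2] at this
      · have := hx i i
        rwa [toMatₗ_apply, dif_neg (lt_irrefl i), dif_neg (lt_irrefl i)] at this
      · have := hx p.1.2 p.1.1
        rwa [toMatₗ_apply, dif_neg p.2.not_gt, dif_pos p.2] at this
    · rintro ⟨h1, h2, h3⟩ i _ j _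
      change toMatₗ d x i j ∈ Set.Icc (0 : ℝ) 1
      rw [toMatₗ_apply]
      split_ifs
      · exact h1 _ (Set.mem_univ _)
      · exact h3 _ (Set.mem_univ _)
      · exact h2 _ (Set.mem_univ _)
  have hmap : (Measure.map (toMat d) volume) K = 1 := by
    refine ((toMat d).toHomeomorph.toMeasurableEquiv.map_apply K).trans ?_
    change volume (toMat d ⁻¹' K) = 1
    rw [hpre, Measure.volume_eq_prod, Measure.prod_prod, Measure.volume_eq_prod,
      Measure.prod_prod]
    simp only [volume_pi_pi, Real.volume_Icc]
    simp
  have := (toMat d).isAddHaarMeasure_map (volume : Measure (Coord d))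
  have h := Measure.isAddLeftInvariant_eq_smul (Measure.map (toMat d) volume)
    (volume : Measure (Mat d))
  have hc := congrArg (fun ν : Measure (Mat d) => ν K) h
  simp only [Measure.smul_apply, hmap, hK] at hc
  rw [h]
  have : (Measure.map (toMat d) volume).addHaarScalarFactor (volume : Measure (Mat d)) = 1 := by
    simpa [ENNReal.smul_def] using hc.symm
  rw [this, one_smul]

/-- The action of left multiplication by `U` in coordinates. -/
def leftCoord {d : ℕ} (U : Mat d) : Coord d →ₗ[ℝ] Coord d :=
  (toMatₗ d).symm.toLinearMap.comp ((LinearMap.mulLeft ℝ U).comp (toMatₗ d).toLinearMap)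

theorem toMatₗ_leftCoord {d : ℕ} (U : Mat d) (x : Coord d) :
    toMatₗ d (leftCoord U x) = U * toMatₗ d x := by
  simp [leftCoord]

/-- Left multiplication by an orthogonal matrix maps the Frobenius unit ball onto itself, and that
ball has positive finite volume. -/
theorem abs_det_leftCoord {d : ℕ} (U : OGroup d) : |LinearMap.det (leftCoord (U : Mat d))| = 1 := by
  let N : Mat d → ℝ := fun Z => (Z.transpose * Z).trace
  have hN : ∀ Z, N Z = ∑ j, ∑ i, Z i j * Z i j := fun Z => by
    simp [N, Matrix.trace, Matrix.mul_apply]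
  have hNc : Continuous N := by fun_prop
  let K : Set (Coord d) := {x | N (toMat d x) ≤ 1}
  have hinv : leftCoord (U : Mat d) '' K = K := by
    have h : ∀ (U : OGroup d) x, x ∈ K → leftCoord (U : Mat d) x ∈ K := fun U x hx => by
      change N (toMatₗ d (leftCoord (U : Mat d) x)) ≤ 1
      rw [toMatₗ_leftCoord]
      have : N ((U : Mat d) * toMatₗ d x) = N (toMatₗ d x) := by
        simp only [N, Matrix.transpose_mul]
        rw [Matrix.mul_assoc, ← Matrix.mul_assoc _ (U : Mat d), U.transpose_mul, one_mul]
      rw [this]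
      exact hx
    refine Set.Subset.antisymm (Set.image_subset_iff.mpr fun x hx => h U x hx) fun x hx =>
      ⟨leftCoord ((U⁻¹ : OGroup d) : Mat d) x, h U⁻¹ x hx, (toMatₗ d).injective ?_⟩
    rw [toMatₗ_leftCoord, toMatₗ_leftCoord, ← mul_assoc, ← Submonoid.coe_mul, mul_inv_cancel,
      OneMemClass.coe_one, one_mul]
  have hcont : Continuous fun x => N (toMat d x) := hNc.comp (toMat d).continuous
  have hK0 : volume K ≠ 0 := by
    have hpos := (isOpen_lt hcont continuous_const).measure_pos volume
      (⟨0, by simp [N]⟩ : {x | N (toMat d x) < 1}.Nonempty)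
    have hsub : {x | N (toMat d x) < 1} ⊆ K := fun x hx => le_of_lt (Set.mem_ofPred.mp hx)
    exact (hpos.trans_le (measure_mono hsub)).ne'
  have hKfin : volume K ≠ ⊤ := by
    have hcpt : IsCompact (Set.pi Set.univ fun _ : Fin d => Set.pi Set.univ fun _ : Fin d =>
      Set.Icc (-1 : ℝ) 1) := isCompact_univ_pi fun _ => isCompact_univ_pi fun _ => isCompact_Icc
    have hcpt' := (toMat d).toHomeomorph.isCompact_preimage.mpr hcpt
    refine (lt_of_le_of_lt (measure_mono fun x hx => ?_) hcpt'.measure_lt_top).ne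
    intro i _ j _
    have h1 : N (toMat d x) ≤ 1 := hx
    rw [hN] at h1
    have h2 : toMat d x i j * toMat d x i j ≤ 1 :=
      (Finset.single_le_sum (f := fun i => toMat d x i j * toMat d x i j)
        (fun k _ => mul_self_nonneg _) (Finset.mem_univ i)).trans
      ((Finset.single_le_sum (f := fun j => ∑ i, toMat d x i j * toMat d x i j)
        (fun k _ => Finset.sum_nonneg fun _ _ => mul_self_nonneg _) (Finset.mem_univ j)).trans h1)
    exact ⟨by change -1 ≤ toMat d x i j; nlinarith, by change toMat d x i j ≤ 1; nlinarith⟩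
  have h := Measure.addHaar_image_linearMap volume (leftCoord (U : Mat d)) K
  rw [hinv] at h
  have h' : ENNReal.ofReal |LinearMap.det (leftCoord (U : Mat d))| = 1 := by
    have := (ENNReal.mul_left_inj hK0 hKfin).mp ((one_mul _).trans h)
    exact this.symm
  simpa using h'

theorem volume_mul_left {d : ℕ} (U : OGroup d) (S : Set (Mat d)) :
    volume ((fun Z : Mat d => (U : Mat d) * Z) '' S) = volume S := by
  have hpre : ∀ S : Set (Mat d), volume (toMat d ⁻¹' S) = volume S := fun S =>
    (measurePreserving_toMat d).measure_preimage_emb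
      (toMat d).toHomeomorph.measurableEmbedding S
  rw [← hpre, ← hpre S]
  have : toMat d ⁻¹' ((fun Z : Mat d => (U : Mat d) * Z) '' S)
      = leftCoord (U : Mat d) '' (toMat d ⁻¹' S) := by
    ext x
    constructor
    · rintro ⟨Z, hZ, h⟩
      refine ⟨(toMat d).symm Z, by simpa using hZ, (toMatₗ d).injective ?_⟩
      rw [toMatₗ_leftCoord]
      exact (congrArg _ ((toMat d).apply_symm_apply Z)).trans h
    · rintro ⟨y, hy, rfl⟩
      exact ⟨toMat d y, hy, (toMatₗ_leftCoord _ _).symm⟩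
  rw [this, Measure.addHaar_image_linearMap, abs_det_leftCoord]
  simp

open scoped Matrix.Norms.Operator in
/-- Change of variables for injective maps from coordinates to matrices. -/
theorem lintegral_image_coord {d : ℕ} {S : Set (Coord d)} (hS : MeasurableSet S)
    {F : Coord d → Mat d} {F' : Coord d → Coord d →L[ℝ] Mat d}
    (hF : ∀ x ∈ S, HasFDerivAt F (F' x) x) (hinj : Set.InjOn F S) (w : Mat d → ENNReal) :
    ∫⁻ W in F '' S, w W = ∫⁻ x in S,
      ENNReal.ofReal |LinearMap.det ((toMatₗ d).symm.toLinearMap.comp (F' x).toLinearMap)| *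
        w (F x) := by
  have h := lintegral_image_eq_lintegral_abs_det_fderiv_mul volume hS
    (f := (toMat d).symm ∘ F) (f' := fun x => (toMat d).symm.toContinuousLinearMap.comp (F' x))
    (fun x hx => ((toMat d).symm.hasFDerivAt.comp x (hF x hx)).hasFDerivWithinAt)
    ((toMat d).symm.injective.comp_injOn hinj) (fun x => w (toMat d x))
  have hmap := (measurePreserving_toMat d).setLIntegral_comp_preimage_emb
    (toMat d).toHomeomorph.measurableEmbedding w (F '' S)
  have hpre : toMat d ⁻¹' (F '' S) = ((toMat d).symm ∘ F) '' S := by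
    rw [Set.image_comp]
    exact ((toMat d).toEquiv.image_symm_eq_preimage _).symm
  rw [← hmap, hpre, h]
  simp only [Function.comp_apply, ContinuousLinearEquiv.apply_symm_apply]
  rfl

/-! ### Exponential coordinates on `O(d)` -/

/-- The entries above the diagonal. -/
def upperₗ (d : ℕ) : Mat d →ₗ[ℝ] Pairs d → ℝ where
  toFun Z p := Z p.1.1 p.1.2
  map_add' _ _ := rfl
  map_smul' _ _ := rfl

theorem upperₗ_apply {d : ℕ} (Z : Mat d) (p : Pairs d) : upperₗ d Z p = Z p.1.1 p.1.2 := rfl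

theorem upperₗ_skew {d : ℕ} (a : Pairs d → ℝ) : upperₗ d (skew a) = a := by
  funext p
  exact dif_pos p.2

theorem skew_upperₗ {d : ℕ} {Z : Mat d} (hZ : Z.transpose = -Z) : skew (upperₗ d Z) = Z := by
  have h : ∀ i j, Z j i = -Z i j := fun i j => congrFun (congrFun hZ i) j
  ext i j
  simp only [skew, Matrix.of_apply, upperₗ_apply]
  rcases lt_trichotomy i j with hij | rfl | hij
  · simp [hij]
  · have := h i i
    simp only [lt_irrefl, dite_false]
    linarith
  · simp [hij, hij.not_gt, ← h]

theorem exp_skew_transpose_mul {d : ℕ} (a : Pairs d → ℝ) :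
    (NormedSpace.exp (skew a)).transpose * NormedSpace.exp (skew a) = 1 := by
  rw [← Matrix.exp_transpose, skew_transpose,
    ← Matrix.exp_add_of_commute _ _ (Commute.refl (skew a)).neg_left, neg_add_cancel,
    NormedSpace.exp_zero]

/-- The exponential coordinates of `O(d)` at the identity. -/
def expO {d : ℕ} (a : Pairs d → ℝ) : OGroup d :=
  ⟨NormedSpace.exp (skew a),
    (Matrix.mem_orthogonalGroup_iff' (Fin d) ℝ).mpr (exp_skew_transpose_mul a)⟩

theorem coe_expO {d : ℕ} (a : Pairs d → ℝ) : (expO a : Mat d) = NormedSpace.exp (skew a) := rfl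

theorem expO_zero {d : ℕ} : (expO 0 : OGroup d) = 1 := by
  have : skew (0 : Pairs d → ℝ) = 0 := map_zero (skewₗ d)
  exact Subtype.ext ((congrArg _ this).trans NormedSpace.exp_zero)

-- Away from `0`, continuity of the derivative suffices; no formula for it is needed.
open scoped Matrix.Norms.Operator in
theorem exists_fderiv_expO (d : ℕ) : ∃ D : (Pairs d → ℝ) → (Pairs d → ℝ) →L[ℝ] Mat d,
    (∀ a, HasFDerivAt (fun a => (expO a : Mat d)) (D a) a) ∧ (∀ α, D 0 α = skew α) ∧
    (∀ α, Continuous fun a => D a α) := by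
  let sk : (Pairs d → ℝ) →L[ℝ] Mat d := (skewₗ d).toContinuousLinearMap
  have hexp : ContDiff ℝ 1 (NormedSpace.exp : Mat d → Mat d) := contDiff_iff_contDiffAt.mpr fun x =>
    (NormedSpace.exp_analytic (𝕂 := ℝ) x).contDiffAt
  have hφ : ContDiff ℝ 1 (fun a : Pairs d → ℝ => (expO a : Mat d)) := hexp.comp sk.contDiff
  refine ⟨fderiv ℝ (fun a => (expO a : Mat d)),
    fun a => (hφ.differentiable one_ne_zero a).hasFDerivAt, fun α => ?_, fun α => ?_⟩
  · have h0 : sk 0 = 0 := map_zero sk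
    have h1 : HasFDerivAt (NormedSpace.exp : Mat d → Mat d) (1 : Mat d →L[ℝ] Mat d) (sk 0) := by
      rw [h0]
      exact (hasStrictFDerivAt_exp_zero (𝕂 := ℝ)).hasFDerivAt
    have h2 : HasFDerivAt (fun a => (expO a : Mat d)) ((1 : Mat d →L[ℝ] Mat d).comp sk) 0 :=
      h1.comp 0 sk.hasFDerivAt
    rw [h2.fderiv]
    rfl
  · exact (hφ.continuous_fderiv one_ne_zero).clm_apply continuous_const

/-- The derivative of the matrix exponential of skew matrices. -/
def expDeriv {d : ℕ} : (Pairs d → ℝ) → (Pairs d → ℝ) →L[ℝ] Mat d := (exists_fderiv_expO d).choose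

theorem hasFDerivAt_expO {d : ℕ} (a : Pairs d → ℝ) :
    HasFDerivAt (fun a => (expO a : Mat d)) (expDeriv a) a := (exists_fderiv_expO d).choose_spec.1 a

theorem expDeriv_zero {d : ℕ} (α : Pairs d → ℝ) : expDeriv 0 α = skew α :=
  (exists_fderiv_expO d).choose_spec.2.1 α

theorem continuous_expDeriv {d : ℕ} (α : Pairs d → ℝ) : Continuous fun a => expDeriv a α :=
  (exists_fderiv_expO d).choose_spec.2.2 α

open scoped Matrix.Norms.Operator in
theorem continuous_coe_expO {d : ℕ} : Continuous fun a : Pairs d → ℝ => (expO a : Mat d) :=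
  continuous_iff_continuousAt.mpr fun a => (hasFDerivAt_expO a).continuousAt

theorem continuous_expO {d : ℕ} : Continuous (expO : (Pairs d → ℝ) → OGroup d) :=
  continuous_coe_expO.subtype_mk _

/-- The derivative of `expO` in the left invariant frame. -/
def expFrame {d : ℕ} (a : Pairs d → ℝ) : (Pairs d → ℝ) →ₗ[ℝ] Pairs d → ℝ :=
  (upperₗ d).comp ((LinearMap.mulLeft ℝ (expO a : Mat d).transpose).comp (expDeriv a).toLinearMap)

-- Differentiating `Eᵀ E = 1` along `E = exp (skew a)` shows that `Eᵀ dE` is skew, hence determined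
-- by its entries above the diagonal.
open scoped Matrix.Norms.Operator in
theorem expDeriv_apply {d : ℕ} (a α : Pairs d → ℝ) :
    expDeriv a α = (expO a : Mat d) * skew (expFrame a α) := by
  let T : Mat d →L[ℝ] Mat d :=
    (Matrix.transposeLinearEquiv (Fin d) (Fin d) ℝ ℝ).toLinearMap.toContinuousLinearMap
  have h1 := hasFDerivAt_expO a
  have h2 : HasFDerivAt (fun a => (expO a : Mat d).transpose) (T.comp (expDeriv a)) a :=
    T.hasFDerivAt.comp a h1
  have h3 := h2.mul' h1
  have h4 : (fun a : Pairs d → ℝ => (expO a : Mat d).transpose) *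
      (fun a : Pairs d → ℝ => (expO a : Mat d)) = fun _ => 1 :=
    funext fun a => (expO a).transpose_mul
  rw [h4] at h3
  have h5 := congrArg (fun D : (Pairs d → ℝ) →L[ℝ] Mat d => D α)
    (h3.unique (hasFDerivAt_const (1 : Mat d) a))
  have h6 : (expO a : Mat d).transpose * expDeriv a α
      + (expDeriv a α).transpose * (expO a : Mat d) = 0 := h5
  have h7 : ((expO a : Mat d).transpose * expDeriv a α).transpose
      = -((expO a : Mat d).transpose * expDeriv a α) := by
    rw [Matrix.transpose_mul, Matrix.transpose_transpose]
    exact eq_neg_of_add_eq_zero_right h6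
  have h8 : skew (expFrame a α) = (expO a : Mat d).transpose * expDeriv a α := skew_upperₗ h7
  rw [h8, ← mul_assoc, (expO a).mul_transpose, one_mul]

/-- The density of Haar measure in exponential coordinates. -/
def expJac {d : ℕ} (a : Pairs d → ℝ) : ℝ := |LinearMap.det (expFrame a)|

theorem expJac_nonneg {d : ℕ} (a : Pairs d → ℝ) : 0 ≤ expJac a := abs_nonneg _

theorem expJac_zero {d : ℕ} : expJac (0 : Pairs d → ℝ) = 1 := by
  have : expFrame (0 : Pairs d → ℝ) = LinearMap.id := by
    refine LinearMap.ext fun α => ?_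
    have h := expDeriv_apply 0 α
    rw [expO_zero, expDeriv_zero, OneMemClass.coe_one, one_mul] at h
    rw [← upperₗ_skew (expFrame 0 α), ← h, upperₗ_skew, LinearMap.id_apply]
  simp [expJac, this]

theorem continuous_expJac {d : ℕ} : Continuous (expJac : (Pairs d → ℝ) → ℝ) := by
  have h : ∀ a : Pairs d → ℝ, expJac a = |(LinearMap.toMatrix' (expFrame a)).det| := fun a => by
    rw [LinearMap.det_toMatrix', expJac]
  simp_rw [funext h]
  refine (Continuous.matrix_det (continuous_matrix fun p q => ?_)).abs
  change Continuous fun a : Pairs d → ℝ =>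
    ((expO a : Mat d).transpose * expDeriv a (Pi.single q 1)) p.1.1 p.1.2
  exact (continuous_coe_expO.matrix_transpose.matrix_mul (continuous_expDeriv _)).matrix_elem _ _

open scoped Matrix.Norms.Operator in
/-- A ball on which the exponential coordinates are injective and cover a neighborhood of `1`. -/
theorem exists_exp_radius (d : ℕ) : ∃ r : ℝ, 0 < r ∧
    Set.InjOn (expO : (Pairs d → ℝ) → OGroup d) (Metric.ball 0 r) ∧
    (expO : (Pairs d → ℝ) → OGroup d) '' Metric.ball 0 r ∈ 𝓝 1 := by
  have hs : HasStrictFDerivAt (NormedSpace.exp : Mat d → Mat d)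
      ((ContinuousLinearEquiv.refl ℝ (Mat d) : Mat d ≃L[ℝ] Mat d) : Mat d →L[ℝ] Mat d) 0 :=
    hasStrictFDerivAt_exp_zero (𝕂 := ℝ)
  let Φ := hs.toOpenPartialHomeomorph NormedSpace.exp
  have hΦ : ∀ X, Φ X = NormedSpace.exp X := fun _ => rfl
  have h0 : (0 : Mat d) ∈ Φ.source := hs.mem_toOpenPartialHomeomorph_source
  have h1 : (1 : Mat d) ∈ Φ.target := by
    have := Φ.map_source h0
    rwa [hΦ, NormedSpace.exp_zero] at this
  have hsymm1 : Φ.symm 1 = 0 := by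
    have := Φ.left_inv h0
    rwa [hΦ, NormedSpace.exp_zero] at this
  have hsk : Continuous (skew : (Pairs d → ℝ) → Mat d) :=
    (skewₗ d).continuous_of_finiteDimensional
  have hsk0 : skew (0 : Pairs d → ℝ) = 0 := map_zero (skewₗ d)
  have hsrc : Φ.source ∈ 𝓝 (0 : Mat d) := Φ.open_source.mem_nhds h0
  obtain ⟨r, hr, hball⟩ := Metric.mem_nhds_iff.mp
    (hsk.continuousAt.preimage_mem_nhds (t := Φ.source) (x := 0) (by rwa [hsk0]))
  refine ⟨r, hr, fun a ha b hb hab => ?_, ?_⟩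
  · have : skew a = skew b := Φ.injOn (hball ha) (hball hb) (congrArg Subtype.val hab)
    rw [← upperₗ_skew a, this, upperₗ_skew]
  · have hcs : ContinuousAt Φ.symm 1 := Φ.continuousAt_symm h1
    have hlim : ∀ {f : Mat d → Mat d}, Continuous f → f 0 = 0 →
        ∀ᶠ Z in 𝓝 (1 : Mat d), f (Φ.symm Z) ∈ Φ.source := fun {f} hf hf0 => by
      have : Tendsto (fun Z => f (Φ.symm Z)) (𝓝 1) (𝓝 0) := by
        have := (hf.continuousAt (x := Φ.symm 1)).tendsto.comp hcs
        rwa [hsymm1, hf0] at this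
      exact this hsrc
    have hup : Continuous (upperₗ d) := (upperₗ d).continuous_of_finiteDimensional
    have hball' : ∀ᶠ Z in 𝓝 (1 : Mat d), upperₗ d (Φ.symm Z) ∈ Metric.ball 0 r := by
      have : Tendsto (fun Z => upperₗ d (Φ.symm Z)) (𝓝 1) (𝓝 0) := by
        have := (hup.continuousAt (x := Φ.symm 1)).tendsto.comp hcs
        rwa [hsymm1, map_zero] at this
      exact this (Metric.ball_mem_nhds 0 hr)
    -- For `U` near `1` let `X` be its local logarithm. Both `-X` and `Xᵀ` lie where `exp` is
    -- injective, and both exponentiate to `U⁻¹ = Uᵀ`; so `X` is skew.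
    have hev := ((hlim continuous_neg neg_zero).and
      (hlim (f := Matrix.transpose) (by fun_prop) Matrix.transpose_zero)).and
      (hball'.and (Φ.open_target.mem_nhds h1))
    have hev' : ∀ᶠ U : OGroup d in 𝓝 1, _ :=
      (continuous_subtype_val.tendsto (1 : OGroup d)).eventually hev
    filter_upwards [hev'] with U hU
    obtain ⟨⟨hneg, htr⟩, hb, htgt⟩ := hU
    have hX : NormedSpace.exp (Φ.symm (U : Mat d)) = (U : Mat d) := Φ.right_inv htgt
    set X := Φ.symm (U : Mat d)
    have hskew : X.transpose = -X := by
      refine Φ.injOn htr hneg ?_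
      rw [hΦ, hΦ, Matrix.exp_transpose, Matrix.exp_neg, hX]
      exact (Matrix.inv_eq_left_inv U.transpose_mul).symm
    exact ⟨upperₗ d X, hb, Subtype.ext (by rw [coe_expO, skew_upperₗ hskew, hX])⟩

/-! ### Haar measure on `O(d)` through the QR decomposition -/

/-- The upper triangular matrix with given diagonal and entries above it. -/
def triₗ (d : ℕ) : (Fin d → ℝ) × (Pairs d → ℝ) →ₗ[ℝ] Mat d :=
  (toMatₗ d).toLinearMap.comp
    ((LinearMap.snd ℝ _ _).prod ((LinearMap.fst ℝ _ _).prod 0))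

theorem triₗ_apply {d : ℕ} (y : (Fin d → ℝ) × (Pairs d → ℝ)) :
    triₗ d y = toMatₗ d (y.2, y.1, 0) := rfl

theorem triₗ_diag {d : ℕ} (y : (Fin d → ℝ) × (Pairs d → ℝ)) (i : Fin d) :
    triₗ d y i i = y.1 i := by
  simp [triₗ_apply, toMatₗ_apply]

theorem triₗ_blockTriangular {d : ℕ} (y : (Fin d → ℝ) × (Pairs d → ℝ)) :
    (triₗ d y).BlockTriangular id := by
  intro i j hij
  have hij : j < i := hij
  rw [triₗ_apply, toMatₗ_apply, dif_neg hij.not_gt, dif_pos hij]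
  rfl

theorem triₗ_injective (d : ℕ) : Function.Injective (triₗ d) := by
  intro y z h
  have h' : (y.2, y.1, (0 : Pairs d → ℝ)) = (z.2, z.1, 0) := (toMatₗ d).injective h
  exact Prod.ext (congrArg (fun x => x.2.1) h') (congrArg Prod.fst h')

theorem continuous_triₗ (d : ℕ) : Continuous (triₗ d) :=
  (triₗ d).continuous_of_finiteDimensional

/-- `Q = U'⁻¹ U` equals `R' R⁻¹`, and its transpose equals `R R'⁻¹`. Both are upper triangular, so
`Q` is diagonal; its entries are `±1`, and positive since the diagonals of `R` and `R'` are. -/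
theorem orthogonal_mul_tri_injective {d : ℕ} {U U' : OGroup d} {R R' : Mat d}
    (hR : R.BlockTriangular id) (hR' : R'.BlockTriangular id) (hpos : ∀ i, 0 < R i i)
    (hpos' : ∀ i, 0 < R' i i) (h : (U : Mat d) * R = (U' : Mat d) * R') : U = U' ∧ R = R' := by
  have hdet : ∀ {R : Mat d}, R.BlockTriangular id → (∀ i, 0 < R i i) → IsUnit R.det :=
    fun {R} hR hpos => by
      rw [Matrix.det_of_isUpperTriangular hR]
      exact (Finset.prod_pos fun i _ => hpos i).ne'.isUnit
  have hu := hdet hR hpos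
  have hu' := hdet hR' hpos'
  let Q : OGroup d := U'⁻¹ * U
  have hQR : (Q : Mat d) * R = R' := by
    have h1 : (U'.1).transpose * (U'.1 * R') = R' := by
      rw [← mul_assoc, U'.transpose_mul, one_mul]
    rw [← h, ← mul_assoc] at h1
    exact h1
  have hQtR : (Q : Mat d).transpose * R' = R := by
    rw [← hQR, ← mul_assoc, Q.transpose_mul, one_mul]
  have hinv : ∀ {R : Mat d}, R.BlockTriangular id → IsUnit R.det →
      R⁻¹.BlockTriangular id := fun {R} hR hu => by
    have := R.invertibleOfIsUnitDet hu
    exact Matrix.blockTriangular_inv_of_blockTriangular hR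
  have hQ : (Q : Mat d).BlockTriangular id := by
    have : (Q : Mat d) = R' * R⁻¹ := by
      rw [← hQR, Matrix.mul_nonsing_inv_cancel_right _ _ hu]
    rw [this]
    exact hR'.mul (hinv hR hu)
  have hQt : (Q : Mat d).transpose.BlockTriangular id := by
    have : (Q : Mat d).transpose = R * R'⁻¹ := by
      rw [← hQtR, Matrix.mul_nonsing_inv_cancel_right _ _ hu']
    rw [this]
    exact hR.mul (hinv hR' hu')
  have hoff : ∀ i j, i ≠ j → (Q : Mat d) i j = 0 := fun i j hij => by
    rcases lt_or_gt_of_ne hij with h | h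
    · exact hQt (show id i < id j from h)
    · exact hQ (show id j < id i from h)
  have hQ1 : (Q : Mat d) = 1 := by
    ext i j
    rcases eq_or_ne i j with rfl | hij
    · have e1 : (Q : Mat d) i i * R i i = R' i i := by
        have : ((Q : Mat d) * R) i i = (Q : Mat d) i i * R i i := by
          rw [Matrix.mul_apply]
          exact Finset.sum_eq_single i (fun k _ hk => by rw [hoff i k hk.symm, zero_mul])
            (by simp)
        rw [← this, hQR]
      have e2 : (Q : Mat d) i i * (Q : Mat d) i i = 1 := by
        have := congrFun (congrFun Q.mul_transpose i) i
        rw [Matrix.mul_apply, Finset.sum_eq_single i (fun k _ hk => by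
          rw [hoff i k hk.symm, zero_mul]) (by simp), Matrix.one_apply_eq] at this
        exact this
      have e3 : 0 < (Q : Mat d) i i := 
        (mul_pos_iff_of_pos_right (hpos i)).mp (e1 ▸ hpos' i)
      rw [Matrix.one_apply_eq]
      nlinarith
    · rw [hoff i j hij, Matrix.one_apply_ne hij]
  refine ⟨?_, by rw [← hQR, hQ1, one_mul]⟩
  have : U'⁻¹ * U = 1 := Subtype.ext hQ1
  exact (inv_mul_eq_one.mp this).symm

/-- A compact box of coordinates of upper triangular matrices with positive diagonal. -/
def triBox (d : ℕ) : Set ((Fin d → ℝ) × (Pairs d → ℝ)) :=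
  (Set.pi Set.univ fun _ => Set.Icc 1 2) ×ˢ (Set.pi Set.univ fun _ => Set.Icc (-1) 1)

theorem isCompact_triBox (d : ℕ) : IsCompact (triBox d) :=
  (isCompact_univ_pi fun _ => isCompact_Icc).prod (isCompact_univ_pi fun _ => isCompact_Icc)

theorem triBox_mem_nhds (d : ℕ) : triBox d ∈ 𝓝 ((fun _ => 3 / 2, 0)) :=
  prod_mem_nhds (set_pi_mem_nhds Set.finite_univ fun _ _ => Icc_mem_nhds (by norm_num)
    (by norm_num)) (set_pi_mem_nhds Set.finite_univ fun _ _ => Icc_mem_nhds (by simp) (by simp))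

theorem triₗ_diag_pos {d : ℕ} {y : (Fin d → ℝ) × (Pairs d → ℝ)} (hy : y ∈ triBox d) (i : Fin d) :
    0 < triₗ d y i i := by
  rw [triₗ_diag]
  exact one_pos.trans_le (hy.1 i (Set.mem_univ i)).1

instance instPolishSpaceTriBox (d : ℕ) : PolishSpace (triBox d) :=
  (isCompact_triBox d).isClosed.polishSpace

instance instCompactSpaceTriBox (d : ℕ) : CompactSpace (triBox d) :=
  isCompact_iff_compactSpace.mp (isCompact_triBox d)

/-- The product of an orthogonal and a triangular matrix. -/
def qrMap {d : ℕ} (x : OGroup d × triBox d) : Mat d := (x.1 : Mat d) * triₗ d x.2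

theorem continuous_qrMap (d : ℕ) : Continuous (qrMap (d := d)) :=
  (continuous_subtype_val.comp continuous_fst).matrix_mul
    ((continuous_triₗ d).comp (continuous_subtype_val.comp continuous_snd))

theorem qrMap_injective (d : ℕ) : Function.Injective (qrMap (d := d)) := by
  rintro ⟨U, y⟩ ⟨U', y'⟩ h
  obtain ⟨h1, h2⟩ := orthogonal_mul_tri_injective (triₗ_blockTriangular y.1)
    (triₗ_blockTriangular y'.1) (triₗ_diag_pos y.2) (triₗ_diag_pos y'.2) h
  exact Prod.ext h1 (Subtype.ext (triₗ_injective d h2))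

theorem measurableEmbedding_qrMap (d : ℕ) : MeasurableEmbedding (qrMap (d := d)) :=
  (continuous_qrMap d).measurableEmbedding (qrMap_injective d)

/-- The volume of the matrices with orthogonal factor in a given set and triangular factor in
`triBox`. -/
def qrMeasure (d : ℕ) : Measure (OGroup d) := (Measure.comap qrMap volume).map Prod.fst

theorem qrMeasure_apply {d : ℕ} {B : Set (OGroup d)} (hB : MeasurableSet B) :
    qrMeasure d B = volume (qrMap '' (Prod.fst ⁻¹' B)) := by
  rw [qrMeasure, Measure.map_apply measurable_fst hB, (measurableEmbedding_qrMap d).comap_apply]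

instance instIsFiniteMeasureQr (d : ℕ) : IsFiniteMeasure (qrMeasure d) := by
  refine ⟨?_⟩
  rw [qrMeasure_apply MeasurableSet.univ, Set.preimage_univ, Set.image_univ]
  exact (isCompact_range (continuous_qrMap d)).measure_lt_top

instance instIsMulLeftInvariantQr (d : ℕ) : (qrMeasure d).IsMulLeftInvariant := by
  refine ⟨fun g => Measure.ext fun B hB => ?_⟩
  rw [Measure.map_apply (measurable_const_mul g) hB,
    qrMeasure_apply (measurable_const_mul g hB), qrMeasure_apply hB, ← volume_mul_left g]
  congr 1
  ext Z
  constructor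
  · rintro ⟨_, ⟨⟨U, y⟩, hU, rfl⟩, rfl⟩
    exact ⟨(g * U, y), hU, mul_assoc (g : Mat d) (U : Mat d) _⟩
  · rintro ⟨⟨U, y⟩, hU, rfl⟩
    refine ⟨_, ⟨(g⁻¹ * U, y), ?_, rfl⟩, ?_⟩
    · change g * (g⁻¹ * U) ∈ B
      rwa [mul_inv_cancel_left]
    · change (g : Mat d) * (((g⁻¹ * U : OGroup d) : Mat d) * triₗ d y) = (U : Mat d) * triₗ d y
      rw [← mul_assoc, ← Submonoid.coe_mul, mul_inv_cancel_left]

/-- The differential of `(a, y) ↦ exp (skew a) * tri y`, up to left translation. -/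
def qrCoord {d : ℕ} (y : (Fin d → ℝ) × (Pairs d → ℝ)) : Coord d →ₗ[ℝ] Coord d :=
  (toMatₗ d).symm.toLinearMap.comp
    (((LinearMap.mulRight ℝ (triₗ d y)).comp (skewₗ d)).coprod (triₗ d))

/-- The Jacobian of the triangular factor. -/
def qrJac {d : ℕ} (y : (Fin d → ℝ) × (Pairs d → ℝ)) : ℝ := |LinearMap.det (qrCoord y)|

theorem continuous_qrJac (d : ℕ) : Continuous (qrJac (d := d)) := by
  have h : ∀ y : (Fin d → ℝ) × (Pairs d → ℝ), qrJac y
      = |(LinearMap.toMatrix (coordBasis d) (coordBasis d) (qrCoord y)).det| := fun y => by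
    rw [LinearMap.det_toMatrix, qrJac]
  simp_rw [funext h]
  refine (Continuous.matrix_det (continuous_matrix fun p q => ?_)).abs
  simp_rw [LinearMap.toMatrix_apply]
  have h1 : Continuous fun y : (Fin d → ℝ) × (Pairs d → ℝ) => qrCoord y (coordBasis d q) := by
    change Continuous fun y : (Fin d → ℝ) × (Pairs d → ℝ) => (toMat d).symm
      (skew (coordBasis d q).1 * triₗ d y + triₗ d (coordBasis d q).2)
    exact (toMat d).symm.continuous.comp
      ((continuous_const.matrix_mul (continuous_triₗ d)).add continuous_const)
  exact ((coordBasis d).coord p).continuous_of_finiteDimensional.comp h1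

/-- At `R = (3/2) I`, a kernel vector would give a skew matrix that is upper triangular, hence zero.
One point is enough: by continuity the integral over the box is then nonzero. -/
theorem qrJac_pos (d : ℕ) : 0 < qrJac (d := d) (fun _ => 3 / 2, 0) := by
  refine abs_pos.mpr ?_
  have htri : triₗ d (fun _ => 3 / 2, 0) = (3 / 2 : ℝ) • (1 : Mat d) := by
    ext i j
    rw [triₗ_apply, toMatₗ_apply]
    rcases lt_trichotomy i j with h | rfl | h
    · simp [h, h.ne]
    · simp
    · simp [h, h.not_gt, h.ne']
  have hinj : Function.Injective (qrCoord (d := d) (fun _ => 3 / 2, 0)) := by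
    rw [← LinearMap.ker_eq_bot, LinearMap.ker_eq_bot']
    rintro ⟨α, y⟩ h
    have h' : skew α * triₗ d (fun _ => 3 / 2, 0) + triₗ d y = 0 := (toMatₗ d).symm.injective
      (h.trans (map_zero _).symm)
    rw [htri, mul_smul_comm, mul_one] at h'
    have hα : α = 0 := by
      funext p
      have := congrFun (congrFun h' p.1.2) p.1.1
      have ht : triₗ d y p.1.2 p.1.1 = 0 := triₗ_blockTriangular y p.2
      rw [Matrix.add_apply, ht, Matrix.smul_apply, skew, Matrix.of_apply, dif_neg p.2.not_gt,
        dif_pos p.2] at this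
      simpa using this
    subst hα
    have h0 : skew (0 : Pairs d → ℝ) = 0 := map_zero (skewₗ d)
    rw [h0, smul_zero, zero_add] at h'
    have : y = 0 := triₗ_injective d (h'.trans (map_zero _).symm)
    rw [this]
    rfl
  exact (LinearEquiv.ofInjectiveEndo _ hinj).isUnit_det'.ne_zero

-- The derivative is left multiplication by `exp (skew a)`, of determinant `±1`, after `qrCoord`,
-- after the left invariant derivative of `exp`. This separates the variables in the Jacobian.
open scoped Matrix.Norms.Operator in
theorem hasFDerivAt_exp_mul_tri {d : ℕ} (x : Coord d) :
    ∃ D : Coord d →L[ℝ] Mat d,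
      HasFDerivAt (fun x : Coord d => (expO x.1 : Mat d) * triₗ d x.2) D x ∧
      |LinearMap.det ((toMatₗ d).symm.toLinearMap.comp D.toLinearMap)|
        = expJac x.1 * qrJac x.2 := by
  let τ : (Fin d → ℝ) × (Pairs d → ℝ) →L[ℝ] Mat d := (triₗ d).toContinuousLinearMap
  let π₁ := ContinuousLinearMap.fst ℝ (Pairs d → ℝ) ((Fin d → ℝ) × (Pairs d → ℝ))
  let π₂ := ContinuousLinearMap.snd ℝ (Pairs d → ℝ) ((Fin d → ℝ) × (Pairs d → ℝ))
  have h1 : HasFDerivAt (fun x : Coord d => (expO x.1 : Mat d)) ((expDeriv x.1).comp π₁) x :=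
    (hasFDerivAt_expO x.1).comp x π₁.hasFDerivAt
  have h2 := (τ.comp π₂).hasFDerivAt (x := x)
  obtain ⟨D, hDx, hD⟩ : ∃ D : Coord d →L[ℝ] Mat d,
      HasFDerivAt (fun x : Coord d => (expO x.1 : Mat d) * triₗ d x.2) D x ∧
      ∀ y : Coord d, D y = (expO x.1 : Mat d) * triₗ d y.2 + expDeriv x.1 y.1 * triₗ d x.2 :=
    ⟨_, h1.mul' h2, fun y => rfl⟩
  refine ⟨D, hDx, ?_⟩
  have hcomp : (toMatₗ d).symm.toLinearMap.comp D.toLinearMap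
      = (leftCoord (expO x.1 : Mat d)).comp
        ((qrCoord x.2).comp ((expFrame x.1).prodMap LinearMap.id)) := by
    refine LinearMap.ext fun y => (toMatₗ d).injective ?_
    simp only [LinearMap.comp_apply, toMatₗ_leftCoord, LinearEquiv.coe_coe,
      LinearEquiv.apply_symm_apply, ContinuousLinearMap.coe_coe, hD, qrCoord]
    change _ = (expO x.1 : Mat d) * (skew (expFrame x.1 y.1) * triₗ d x.2 + triₗ d y.2)
    rw [mul_add, ← mul_assoc, ← expDeriv_apply, add_comm]
  rw [hcomp, LinearMap.det_comp, LinearMap.det_comp, LinearMap.det_prodMap,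
    LinearMap.det_id, mul_one, abs_mul, abs_mul, abs_det_leftCoord, one_mul, mul_comm]
  rfl

/-- The radius of a ball of exponential coordinates. -/
def expRadius (d : ℕ) : ℝ := (exists_exp_radius d).choose

theorem expRadius_pos (d : ℕ) : 0 < expRadius d := (exists_exp_radius d).choose_spec.1

theorem injOn_expO (d : ℕ) :
    Set.InjOn (expO : (Pairs d → ℝ) → OGroup d) (Metric.ball 0 (expRadius d)) :=
  (exists_exp_radius d).choose_spec.2.1

theorem image_expO_mem_nhds (d : ℕ) :
    (expO : (Pairs d → ℝ) → OGroup d) '' Metric.ball 0 (expRadius d) ∈ 𝓝 1 :=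
  (exists_exp_radius d).choose_spec.2.2

theorem measurableSet_image_expO {d : ℕ} {B : Set (Pairs d → ℝ)} (hB : MeasurableSet B)
    (hsub : B ⊆ Metric.ball 0 (expRadius d)) : MeasurableSet (expO '' B : Set (OGroup d)) :=
  hB.image_of_continuousOn_injOn continuous_expO.continuousOn ((injOn_expO d).mono hsub)

/-- The integral of the Jacobian of the triangular factor. -/
def qrConst (d : ℕ) : ENNReal := ∫⁻ y in triBox d, ENNReal.ofReal (qrJac y)

/-- Change of variables and Tonelli: the triangular variables integrate to a constant independent of
`B`. -/
theorem qrMeasure_image_expO {d : ℕ} {B : Set (Pairs d → ℝ)} (hB : MeasurableSet B)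
    (hsub : B ⊆ Metric.ball 0 (expRadius d)) :
    qrMeasure d (expO '' B) = (∫⁻ a in B, ENNReal.ofReal (expJac a)) * qrConst d := by
  have himg : qrMap '' (Prod.fst ⁻¹' (expO '' B))
      = (fun x : Coord d => (expO x.1 : Mat d) * triₗ d x.2) '' (B ×ˢ triBox d) := by
    ext Z
    constructor
    · rintro ⟨⟨U, y⟩, ⟨a, ha, rfl⟩, rfl⟩
      exact ⟨(a, y), ⟨ha, y.2⟩, rfl⟩
    · rintro ⟨⟨a, y⟩, ⟨ha, hy⟩, rfl⟩
      exact ⟨(expO a, ⟨y, hy⟩), ⟨a, ha, rfl⟩, rfl⟩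
  have hinj : Set.InjOn (fun x : Coord d => (expO x.1 : Mat d) * triₗ d x.2)
      (B ×ˢ triBox d) := by
    rintro ⟨a, y⟩ ⟨ha, hy⟩ ⟨a', y'⟩ ⟨ha', hy'⟩ h
    have := qrMap_injective d (a₁ := (expO a, ⟨y, hy⟩)) (a₂ := (expO a', ⟨y', hy'⟩)) h
    simp only [Prod.mk.injEq, Subtype.mk.injEq] at this
    exact Prod.ext (injOn_expO d (hsub ha) (hsub ha') this.1) this.2
  choose D hD hdet using hasFDerivAt_exp_mul_tri (d := d)
  have h := lintegral_image_coord (hB.prod (isCompact_triBox d).measurableSet)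
    (fun x _ => hD x) hinj (fun _ => 1)
  rw [qrMeasure_apply (measurableSet_image_expO hB hsub), himg, ← setLIntegral_one, h,
    qrConst, Measure.volume_eq_prod, ← Measure.prod_restrict, ← lintegral_prod_mul
      (continuous_expJac.measurable.ennreal_ofReal.aemeasurable)
      ((continuous_qrJac d).measurable.ennreal_ofReal.aemeasurable)]
  refine lintegral_congr fun x => ?_
  rw [hdet, mul_one, ENNReal.ofReal_mul (expJac_nonneg _)]

theorem setLIntegral_ofReal_ne_zero {X : Type*} [TopologicalSpace X] [MeasurableSpace X]
    [OpensMeasurableSpace X] (μ : Measure X) [μ.IsOpenPosMeasure] {f : X → ℝ} (hf : Continuous f)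
    {s : Set X} {x : X} (hs : s ∈ 𝓝 x) (hx : 0 < f x) :
    ∫⁻ y in s, ENNReal.ofReal (f y) ∂μ ≠ 0 := by
  obtain ⟨O, hO, hOo, hxO⟩ := mem_nhds_iff.mp
    (inter_mem hs ((isOpen_lt continuous_const hf).mem_nhds hx))
  intro h
  have h1 : ∫⁻ y in O, ENNReal.ofReal (f y) ∂μ = 0 :=
    le_antisymm (h ▸ lintegral_mono_set fun y hy => (hO hy).1) zero_le
  rw [setLIntegral_eq_zero_iff hOo.measurableSet hf.measurable.ennreal_ofReal] at h1
  have h2 : ∀ᵐ y ∂μ, y ∉ O := h1.mono fun y hy hyO => by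
    have h3 : 0 < f y := (hO hyO).2
    exact h3.not_ge (ENNReal.ofReal_eq_zero.mp (hy hyO))
  have h3 : μ O = 0 := by simpa [ae_iff] using h2
  exact (hOo.measure_pos μ ⟨x, hxO⟩).ne' h3

theorem qrConst_ne_zero (d : ℕ) : qrConst d ≠ 0 :=
  setLIntegral_ofReal_ne_zero volume (continuous_qrJac d) (triBox_mem_nhds d) (qrJac_pos d)

theorem lintegral_expJac_ne_zero (d : ℕ) :
    ∫⁻ a in Metric.ball (0 : Pairs d → ℝ) (expRadius d), ENNReal.ofReal (expJac a) ≠ 0 :=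
  setLIntegral_ofReal_ne_zero volume continuous_expJac (Metric.ball_mem_nhds 0 (expRadius_pos d))
    (expJac_zero ▸ one_pos)

/-- Otherwise the chart ball would have infinite measure, although `qrMeasure` is finite. -/
theorem qrConst_ne_top (d : ℕ) : qrConst d ≠ ⊤ := by
  intro h
  have h1 := qrMeasure_image_expO (d := d) measurableSet_ball subset_rfl
  rw [h, ENNReal.mul_top (lintegral_expJac_ne_zero d)] at h1
  exact measure_ne_top _ _ h1

/-- Haar measure on `O(d)`, normalized in exponential coordinates. -/
def haarO (d : ℕ) : Measure (OGroup d) := (qrConst d)⁻¹ • qrMeasure d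

theorem haarO_image_expO {d : ℕ} {B : Set (Pairs d → ℝ)} (hB : MeasurableSet B)
    (hsub : B ⊆ Metric.ball 0 (expRadius d)) :
    haarO d (expO '' B) = ∫⁻ a in B, ENNReal.ofReal (expJac a) := by
  rw [haarO, Measure.smul_apply, qrMeasure_image_expO hB hsub, smul_eq_mul, mul_comm, mul_assoc,
    ENNReal.mul_inv_cancel (qrConst_ne_zero d) (qrConst_ne_top d), mul_one]

instance instIsHaarMeasureHaarO (d : ℕ) : (haarO d).IsHaarMeasure := by
  let μ₀ : Measure (OGroup d) := Measure.haar
  have h := Measure.isMulLeftInvariant_eq_smul (qrMeasure d) μ₀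
  have hc : (qrMeasure d).haarScalarFactor μ₀ ≠ 0 := by
    intro hc
    have h1 := qrMeasure_image_expO (d := d) measurableSet_ball subset_rfl
    rw [h, hc, zero_smul] at h1
    exact mul_ne_zero (lintegral_expJac_ne_zero d) (qrConst_ne_zero d) h1.symm
  have : (qrMeasure d).IsHaarMeasure := by
    rw [h]
    exact Measure.IsHaarMeasure.smul μ₀ (by simpa using hc) ENNReal.coe_ne_top
  exact Measure.IsHaarMeasure.smul _ (ENNReal.inv_ne_zero.mpr (qrConst_ne_top d))
    (ENNReal.inv_ne_top.mpr (qrConst_ne_zero d))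

theorem tendsto_lintegral_div_closedBall {ι : Type*} [Fintype ι] {f : (ι → ℝ) → ENNReal}
    (hf : ContinuousAt f 0) :
    Tendsto (fun r : ℝ => (∫⁻ a in Metric.closedBall (0 : ι → ℝ) r, f a)
      / volume (Metric.closedBall (0 : ι → ℝ) r)) (𝓝[>] 0) (𝓝 (f 0)) := by
  have hev : ∀ {p : (ι → ℝ) → Prop}, (∀ᶠ a in 𝓝 0, p a) →
      ∀ᶠ r in 𝓝[>] (0 : ℝ), 0 < r ∧ ∀ a ∈ Metric.closedBall (0 : ι → ℝ) r, p a := by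
    intro p hp
    obtain ⟨ε, hε, h⟩ := Metric.eventually_nhds_iff_ball.mp hp
    filter_upwards [Ioo_mem_nhdsGT hε] with r hr
    exact ⟨hr.1, fun a ha => h a (Metric.closedBall_subset_ball hr.2 ha)⟩
  have hv0 : ∀ {r : ℝ}, 0 < r → volume (Metric.closedBall (0 : ι → ℝ) r) ≠ 0 := fun hr =>
    (Metric.measure_closedBall_pos volume _ hr).ne'
  have hvt : ∀ {r : ℝ}, volume (Metric.closedBall (0 : ι → ℝ) r) ≠ ⊤ := fun {r} =>
    (isCompact_closedBall _ _).measure_lt_top.ne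
  refine tendsto_order.mpr ⟨fun b hb => ?_, fun b hb => ?_⟩
  · obtain ⟨c, hbc, hcf⟩ := exists_between hb
    filter_upwards [hev (hf.eventually_const_lt hcf)] with r hr
    refine hbc.trans_le ((ENNReal.le_div_iff_mul_le (Or.inl (hv0 hr.1)) (Or.inl hvt)).mpr ?_)
    rw [← setLIntegral_const]
    exact setLIntegral_mono' measurableSet_closedBall fun a ha => (hr.2 a ha).le
  · obtain ⟨c, hfc, hcb⟩ := exists_between hb
    filter_upwards [hev (hf.eventually_lt_const hfc)] with r hr
    refine lt_of_le_of_lt ((ENNReal.div_le_iff (hv0 hr.1) hvt).mpr ?_) hcb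
    rw [← setLIntegral_const]
    exact setLIntegral_mono' measurableSet_closedBall fun a ha => (hr.2 a ha).le

theorem isHaarO_haarO (d : ℕ) : IsHaarO (haarO d) := by
  refine ⟨inferInstance, ?_⟩
  have h := tendsto_lintegral_div_closedBall (ι := Pairs d)
    (f := fun a => ENNReal.ofReal (expJac a))
    (ENNReal.continuous_ofReal.comp continuous_expJac).continuousAt
  rw [expJac_zero, ENNReal.ofReal_one] at h
  refine h.congr' ?_
  filter_upwards [Ioo_mem_nhdsGT (expRadius_pos d)] with r hr
  rw [← haarO_image_expO measurableSet_closedBall (Metric.closedBall_subset_ball hr.2)]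
  congr 2
  ext U
  exact ⟨fun ⟨a, ha, h⟩ => ⟨a, ha, congrArg Subtype.val h.symm⟩,
    fun ⟨a, ha, h⟩ => ⟨a, ha, Subtype.ext h.symm⟩⟩

/-- Haar measures are proportional, and the common limit 1 at the identity forces the factor to be
1. -/
theorem IsHaarO.eq_haarO {d : ℕ} {μ : Measure (OGroup d)} (hμ : IsHaarO μ) : μ = haarO d := by
  have := hμ.haar
  have h := Measure.isMulLeftInvariant_eq_smul μ (haarO d)
  have h1 := hμ.unit_at_one
  have h2 := ENNReal.Tendsto.const_mul (a := (μ.haarScalarFactor (haarO d) : ENNReal))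
    (isHaarO_haarO d).unit_at_one (Or.inl one_ne_zero)
  rw [h] at h1
  simp only [Measure.smul_apply, ENNReal.smul_def, smul_eq_mul, mul_div_assoc] at h1
  have hc := tendsto_nhds_unique h1 h2
  rw [mul_one] at hc
  rw [h]
  have : μ.haarScalarFactor (haarO d) = 1 := by
    exact_mod_cast hc.symm
  rw [this, one_smul]

/-! ### From the pointwise formula to measures -/

/-- The volume of the image of a frame is the determinant times the volume of the standard frame. -/
theorem volumeOn_map {d : ℕ} {g : Mat d → Mat d → Mat d → ℝ} {W : Mat d}
    {B : LinearMap.BilinForm ℝ (Mat d)} (hB : ∀ X Y, g W X Y = B X Y) (L : Coord d →ₗ[ℝ] Mat d) :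
    volumeOn g W (fun a => L (coordBasis d a))
      = |LinearMap.det ((toMatₗ d).symm.toLinearMap.comp L)| *
        volumeOn g W (fun p : Fin d × Fin d => Matrix.single p.1 p.2 (1 : ℝ)) := by
  have h1 : (Matrix.of fun a b => g W (L (coordBasis d a)) (L (coordBasis d b)))
      = Matrix.of fun a b => (B.comp (toMatₗ d).toLinearMap (toMatₗ d).toLinearMap)
        (((toMatₗ d).symm.toLinearMap.comp L) (coordBasis d a))
        (((toMatₗ d).symm.toLinearMap.comp L) (coordBasis d b)) := by
    ext a b
    simp [hB]
  have h2 : (Matrix.of fun a b => (B.comp (toMatₗ d).toLinearMap (toMatₗ d).toLinearMap)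
      (coordBasis d a) (coordBasis d b))
      = (Matrix.of fun p q : Fin d × Fin d => g W (Matrix.single p.1 p.2 (1 : ℝ))
        (Matrix.single q.1 q.2 (1 : ℝ))).submatrix (idxEquiv d) (idxEquiv d) := by
    ext a b
    simp [hB, toMatₗ_coordBasis]
  rw [volumeOn, h1, det_gram_comp, h2, Matrix.det_submatrix_equiv_self,
    Real.sqrt_mul (sq_nonneg _), Real.sqrt_sq_eq_abs]
  rfl

/-- The parametrization of triples `(U, σ, V)` by exponential coordinates around `(U, V)`. -/
def svdChart {d : ℕ} (U V : OGroup d) (x : Coord d) : OGroup d × (Fin d → ℝ) × OGroup d :=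
  (U * expO x.1, x.2.1, V * expO x.2.2)

/-- The singular value parametrization, on triples with orthogonal factors. -/
def svdO {d : ℕ} (x : OGroup d × (Fin d → ℝ) × OGroup d) : Mat d :=
  svdMap ((x.1 : Mat d), x.2.1, (x.2.2 : Mat d))

theorem continuous_svdO (d : ℕ) : Continuous (svdO (d := d)) := by
  unfold svdO svdMap
  fun_prop

-- By the chain rule, the chart in left invariant frames has derivative `expFrame × id × expFrame`;
-- hence the Jacobian is that of the SVD map on its frame times the two Haar densities.
open scoped Matrix.Norms.Operator in
theorem hasFDerivAt_svdO_chart {d : ℕ} (U V : OGroup d) (x : Coord d) :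
    ∃ D : Coord d →L[ℝ] Mat d, HasFDerivAt (fun x => svdO (svdChart U V x)) D x ∧
      |LinearMap.det ((toMatₗ d).symm.toLinearMap.comp D.toLinearMap)|
        = |LinearMap.det ((toMatₗ d).symm.toLinearMap.comp
            ((fderiv ℝ svdMap (((svdChart U V x).1 : Mat d), x.2.1,
              ((svdChart U V x).2.2 : Mat d))).toLinearMap.comp
              (frameMap ((svdChart U V x).1 : Mat d) ((svdChart U V x).2.2 : Mat d))))| *
          (expJac x.1 * expJac x.2.2) := by
  let π₁ := ContinuousLinearMap.fst ℝ (Pairs d → ℝ) ((Fin d → ℝ) × (Pairs d → ℝ))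
  let π₂ := (ContinuousLinearMap.fst ℝ (Fin d → ℝ) (Pairs d → ℝ)).comp
    (ContinuousLinearMap.snd ℝ (Pairs d → ℝ) ((Fin d → ℝ) × (Pairs d → ℝ)))
  let π₃ := (ContinuousLinearMap.snd ℝ (Fin d → ℝ) (Pairs d → ℝ)).comp
    (ContinuousLinearMap.snd ℝ (Pairs d → ℝ) ((Fin d → ℝ) × (Pairs d → ℝ)))
  let mU : Mat d →L[ℝ] Mat d := (LinearMap.mulLeft ℝ (U : Mat d)).toContinuousLinearMap
  let mV : Mat d →L[ℝ] Mat d := (LinearMap.mulLeft ℝ (V : Mat d)).toContinuousLinearMap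
  have h1 : HasFDerivAt (fun x : Coord d => (U : Mat d) * (expO x.1 : Mat d))
      (mU.comp ((expDeriv x.1).comp π₁)) x :=
    mU.hasFDerivAt.comp x ((hasFDerivAt_expO x.1).comp x π₁.hasFDerivAt)
  have h3 : HasFDerivAt (fun x : Coord d => (V : Mat d) * (expO x.2.2 : Mat d))
      (mV.comp ((expDeriv x.2.2).comp π₃)) x :=
    mV.hasFDerivAt.comp x (HasFDerivAt.comp (g := fun b : Pairs d → ℝ => (expO b : Mat d)) x
      (hasFDerivAt_expO x.2.2) π₃.hasFDerivAt)
  have h2 := π₂.hasFDerivAt (x := x)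
  obtain ⟨D₀, hD₀, -⟩ := hasFDerivAt_svdMap (((svdChart U V x).1 : Mat d), x.2.1,
    ((svdChart U V x).2.2 : Mat d))
  obtain ⟨D, hDx, hD⟩ : ∃ D : Coord d →L[ℝ] Mat d,
      HasFDerivAt (fun x => svdO (svdChart U V x)) D x ∧
      ∀ y : Coord d, D y = D₀ ((U : Mat d) * expDeriv x.1 y.1, y.2.1,
        (V : Mat d) * expDeriv x.2.2 y.2.2) :=
    ⟨_, hD₀.comp x (h1.prodMk (h2.prodMk h3)), fun y => rfl⟩
  refine ⟨D, hDx, ?_⟩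
  rw [hD₀.fderiv]
  have hcomp : (toMatₗ d).symm.toLinearMap.comp D.toLinearMap
      = ((toMatₗ d).symm.toLinearMap.comp (D₀.toLinearMap.comp
          (frameMap ((svdChart U V x).1 : Mat d) ((svdChart U V x).2.2 : Mat d)))).comp
        ((expFrame x.1).prodMap (LinearMap.id.prodMap (expFrame x.2.2))) := by
    refine LinearMap.ext fun y => congrArg (toMatₗ d).symm ?_
    refine (hD y).trans (congrArg D₀ ?_)
    rw [expDeriv_apply, expDeriv_apply, ← mul_assoc, ← mul_assoc]
    rfl
  rw [hcomp, LinearMap.det_comp, LinearMap.det_prodMap, LinearMap.det_prodMap, LinearMap.det_id,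
    one_mul, abs_mul, abs_mul]
  rfl

/-- The translate of the exponential chart domain to `U`. -/
def expDomain {d : ℕ} (U : OGroup d) : Set (OGroup d) :=
  (fun a => U * expO a) '' Metric.ball 0 (expRadius d)

theorem expDomain_eq {d : ℕ} (U : OGroup d) :
    expDomain U = (fun Q => U⁻¹ * Q) ⁻¹' (expO '' Metric.ball 0 (expRadius d)) := by
  ext Q
  constructor
  · rintro ⟨a, ha, rfl⟩
    exact ⟨a, ha, (inv_mul_cancel_left _ _).symm⟩
  · rintro ⟨a, ha, h⟩
    refine ⟨a, ha, ?_⟩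
    change U * expO a = Q
    rw [h, mul_inv_cancel_left]

theorem measurableSet_expDomain {d : ℕ} (U : OGroup d) : MeasurableSet (expDomain U) := by
  rw [expDomain_eq]
  exact measurable_const_mul _ (measurableSet_image_expO measurableSet_ball subset_rfl)

theorem exists_finset_expDomain (d : ℕ) : ∃ t : Finset (OGroup d), ∀ Q, ∃ U ∈ t, Q ∈ expDomain U := by
  obtain ⟨t, ht⟩ := compact_covered_by_mul_left_translates
    (isCompact_univ (X := OGroup d)) (V := expO '' Metric.ball 0 (expRadius d))
    ⟨1, mem_interior_iff_mem_nhds.mpr (image_expO_mem_nhds d)⟩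
  -- The covering lemma yields `g` with `g Q` in the chart at `1`, so `Q` lies in the chart at
  -- `g⁻¹`.
  classical
  refine ⟨t.image (·⁻¹), fun Q => ?_⟩
  obtain ⟨g, hg, hQ⟩ := Set.mem_iUnion₂.mp (ht (Set.mem_univ Q))
  refine ⟨g⁻¹, Finset.mem_image_of_mem _ hg, ?_⟩
  rw [expDomain_eq, inv_inv]
  exact hQ

/-- Lebesgue measure on the exponential coordinates, weighted by the density of Haar measure. -/
def expMeasure (d : ℕ) : Measure (Pairs d → ℝ) :=
  (volume.restrict (Metric.ball 0 (expRadius d))).withDensity fun a => ENNReal.ofReal (expJac a)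

instance instSFiniteExpMeasure (d : ℕ) : SFinite (expMeasure d) := by
  unfold expMeasure
  infer_instance

/-- Left invariance moves the chart at `U` to the identity, so every chart has the same density
`expJac`. -/
theorem haarO_restrict_expDomain {d : ℕ} (U : OGroup d) :
    (haarO d).restrict (expDomain U) = (expMeasure d).map fun a => U * expO a := by
  have hm : Measurable fun a : Pairs d → ℝ => U * expO a :=
    (continuous_const.mul continuous_expO).measurable
  refine Measure.ext fun B hB => ?_
  rw [Measure.restrict_apply hB, Measure.map_apply hm hB, expMeasure,
    withDensity_apply _ (hm hB), Measure.restrict_restrict (hm hB),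
    ← haarO_image_expO ((hm hB).inter measurableSet_ball) Set.inter_subset_right,
    ← measure_preimage_mul (haarO d) U]
  congr 1
  ext Q
  constructor
  · rintro ⟨hQB, a, ha, h⟩
    have h : expO a = Q := mul_left_cancel h
    subst h
    exact ⟨a, ⟨hQB, ha⟩, rfl⟩
  · rintro ⟨a, ⟨haB, ha⟩, rfl⟩
    exact ⟨haB, a, ha, rfl⟩

theorem haarO_prod_restrict {d : ℕ} (U V : OGroup d) :
    ((haarO d).prod (volume.prod (haarO d))).restrict
        (expDomain U ×ˢ ((Set.univ : Set (Fin d → ℝ)) ×ˢ expDomain V))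
      = ((volume.restrict (Metric.ball 0 (expRadius d) ×ˢ
          ((Set.univ : Set (Fin d → ℝ)) ×ˢ Metric.ball 0 (expRadius d)))).withDensity
        fun x : Coord d => ENNReal.ofReal (expJac x.1) * ENNReal.ofReal (expJac x.2.2)).map
        (svdChart U V) := by
  have hJ : Measurable fun a : Pairs d → ℝ => ENNReal.ofReal (expJac a) :=
    continuous_expJac.measurable.ennreal_ofReal
  have hm : ∀ U : OGroup d, Measurable fun a : Pairs d → ℝ => U * expO a := fun U =>
    (continuous_const.mul continuous_expO).measurable
  rw [← Measure.prod_restrict, ← Measure.prod_restrict, haarO_restrict_expDomain,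
    haarO_restrict_expDomain, Measure.restrict_univ]
  nth_rw 1 [← Measure.map_id (μ := (volume : Measure (Fin d → ℝ)))]
  rw [Measure.map_prod_map _ _ measurable_id (hm V),
    Measure.map_prod_map _ _ (hm U) (measurable_id.prodMap (hm V)), expMeasure,
    prod_withDensity_right hJ,
    prod_withDensity (g := fun z : (Fin d → ℝ) × (Pairs d → ℝ) => ENNReal.ofReal (expJac z.2)) hJ
      (hJ.comp measurable_snd),
    Measure.volume_eq_prod, Measure.volume_eq_prod, ← Measure.prod_restrict,
    ← Measure.prod_restrict, Measure.restrict_univ]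
  rfl

theorem measurable_svdChart {d : ℕ} (U V : OGroup d) : Measurable (svdChart U V) := by
  refine Continuous.measurable ?_
  have := continuous_expO (d := d)
  unfold svdChart
  fun_prop

theorem isUnit_det_svdO {d : ℕ} {x : OGroup d × (Fin d → ℝ) × OGroup d} (hx : IsSingVals x.2.1) :
    IsUnit (svdO x).det := by
  have h1 : IsUnit (x.1 : Mat d).det := Matrix.isUnit_det_of_left_inverse x.1.transpose_mul
  have h2 : IsUnit (x.2.2 : Mat d).transpose.det :=
    Matrix.isUnit_det_of_right_inverse x.2.2.transpose_mul
  rw [svdO, svdMap, Matrix.det_mul, Matrix.det_mul, Matrix.det_diagonal]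
  exact (h1.mul (Finset.prod_pos fun i _ => hx.2 i).ne'.isUnit).mul h2

theorem volumeMeasure_apply {d : ℕ} (g : Mat d → Mat d → Mat d → ℝ) {T : Set (Mat d)}
    (hT : MeasurableSet T) (hunit : ∀ W ∈ T, IsUnit W.det) :
    volumeMeasure g T = ∫⁻ W in T, ENNReal.ofReal
      (volumeOn g W fun p : Fin d × Fin d => Matrix.single p.1 p.2 (1 : ℝ)) := by
  rw [volumeMeasure, withDensity_apply _ hT, Measure.restrict_restrict hT,
    Set.inter_eq_left.mpr (show T ⊆ {W : Mat d | IsUnit W.det} from hunit)]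

section

variable {d : ℕ} {g : Mat d → Mat d → Mat d → ℝ} {ρ : (Fin d → ℝ) → ℝ}

/-- The volume formula on a chart domain. -/
theorem volumeMeasure_image_chart
    (hbil : ∀ (U V : OGroup d) (σ : Fin d → ℝ), IsSingVals σ → ∃ B : LinearMap.BilinForm ℝ (Mat d),
      ∀ X Y, g (svdMap ((U : Mat d), σ, (V : Mat d))) X Y = B X Y)
    (hpt : ∀ (U V : OGroup d) (σ : Fin d → ℝ), IsSingVals σ →
      volumeOn g (svdMap ((U : Mat d), σ, (V : Mat d)))
        (fun a => fderiv ℝ svdMap ((U : Mat d), σ, (V : Mat d)) (svdFrame (U : Mat d) (V : Mat d) a))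
      = ρ σ)
    (hρ : Measurable ρ) (U V : OGroup d) {S : Set (OGroup d × (Fin d → ℝ) × OGroup d)}
    (hS : MeasurableSet S) (hsing : ∀ x ∈ S, IsSingVals x.2.1) (hinj : Set.InjOn svdO S)
    (hsub : S ⊆ expDomain U ×ˢ ((Set.univ : Set (Fin d → ℝ)) ×ˢ expDomain V)) :
    volumeMeasure g (svdO '' S)
      = ∫⁻ x in S, ENNReal.ofReal (ρ x.2.1) ∂((haarO d).prod (volume.prod (haarO d))) := by
  have hχ := measurable_svdChart U V
  let box : Set (Coord d) := Metric.ball 0 (expRadius d) ×ˢ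
    ((Set.univ : Set (Fin d → ℝ)) ×ˢ Metric.ball 0 (expRadius d))
  have hbox : MeasurableSet box :=
    measurableSet_ball.prod (MeasurableSet.univ.prod measurableSet_ball)
  have hS' : MeasurableSet (svdChart U V ⁻¹' S ∩ box) := (hχ hS).inter hbox
  have himg : svdO '' S = (fun x => svdO (svdChart U V x)) '' (svdChart U V ⁻¹' S ∩ box) := by
    ext W
    constructor
    · rintro ⟨x, hx, rfl⟩
      obtain ⟨⟨a, ha, h1⟩, -, b, hb, h2⟩ := hsub hx
      have h : svdChart U V (a, x.2.1, b) = x := Prod.ext h1 (Prod.ext rfl h2)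
      refine ⟨(a, x.2.1, b), ⟨?_, ha, Set.mem_univ _, hb⟩, congrArg svdO h⟩
      rw [Set.mem_preimage, h]
      exact hx
    · rintro ⟨y, hy, rfl⟩
      exact ⟨_, hy.1, rfl⟩
  have hinj' : Set.InjOn (fun x => svdO (svdChart U V x)) (svdChart U V ⁻¹' S ∩ box) := by
    intro x hx y hy h
    have h := hinj hx.1 hy.1 h
    have h1 : expO x.1 = expO y.1 := mul_left_cancel (congrArg Prod.fst h)
    have h2 : expO x.2.2 = expO y.2.2 := mul_left_cancel (congrArg (fun z => z.2.2) h)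
    exact Prod.ext (injOn_expO d hx.2.1 hy.2.1 h1) (Prod.ext (congrArg (fun z => z.2.1) h)
      (injOn_expO d hx.2.2.2 hy.2.2.2 h2))
  -- The Lusin–Souslin theorem: an injective continuous image of a Borel set in a Polish space is
  -- Borel.
  have hmeas : MeasurableSet (svdO '' S) :=
    hS.image_of_continuousOn_injOn (continuous_svdO d).continuousOn hinj
  choose D hD hdet using hasFDerivAt_svdO_chart U V
  have hrestr : ((haarO d).prod (volume.prod (haarO d))).restrict S
      = ((volume.restrict (svdChart U V ⁻¹' S ∩ box)).withDensity
        fun x : Coord d => ENNReal.ofReal (expJac x.1) * ENNReal.ofReal (expJac x.2.2)).map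
        (svdChart U V) := by
    rw [← Set.inter_eq_left.mpr hsub, ← Measure.restrict_restrict hS, haarO_prod_restrict,
      Measure.restrict_map hχ hS, restrict_withDensity (hχ hS), Measure.restrict_restrict (hχ hS),
      Set.inter_eq_left.mpr hsub]
  have hρ' : Measurable fun x : OGroup d × (Fin d → ℝ) × OGroup d => ENNReal.ofReal (ρ x.2.1) :=
    (hρ.comp (measurable_fst.comp measurable_snd)).ennreal_ofReal
  have hJ : Measurable fun x : Coord d =>
      ENNReal.ofReal (expJac x.1) * ENNReal.ofReal (expJac x.2.2) :=
    (continuous_expJac.measurable.ennreal_ofReal.comp measurable_fst).mul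
      (continuous_expJac.measurable.ennreal_ofReal.comp (measurable_snd.comp measurable_snd))
  rw [hrestr, lintegral_map hρ' hχ, lintegral_withDensity_eq_lintegral_mul _ hJ
      (g := fun x => ENNReal.ofReal (ρ (svdChart U V x).2.1)) (hρ'.comp hχ),
    volumeMeasure_apply g hmeas (by rintro _ ⟨x, hx, rfl⟩; exact isUnit_det_svdO (hsing x hx)),
    himg, lintegral_image_coord hS' (fun x _ => hD x) hinj']
  -- The integrands agree pointwise: the Jacobian of the SVD map on its frame times `√(det g)` in
  -- the standard frame is the pointwise density `ρ`, and the factors `expJac` match.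
  refine setLIntegral_congr_fun hS' fun x hx => ?_
  have hσ : IsSingVals x.2.1 := hsing _ hx.1
  obtain ⟨B, hB⟩ := hbil (svdChart U V x).1 (svdChart U V x).2.2 x.2.1 hσ
  have hvol := volumeOn_map hB ((fderiv ℝ svdMap (((svdChart U V x).1 : Mat d), x.2.1,
    ((svdChart U V x).2.2 : Mat d))).toLinearMap.comp
      (frameMap ((svdChart U V x).1 : Mat d) ((svdChart U V x).2.2 : Mat d)))
  simp only [LinearMap.comp_apply, frameMap_coordBasis, ContinuousLinearMap.coe_coe] at hvol
  rw [hpt _ _ _ hσ] at hvol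
  simp only [Pi.mul_apply, hdet]
  rw [← ENNReal.ofReal_mul (mul_nonneg (abs_nonneg _)
    (mul_nonneg (expJac_nonneg _) (expJac_nonneg _))), ← ENNReal.ofReal_mul (expJac_nonneg _),
    ← ENNReal.ofReal_mul (mul_nonneg (expJac_nonneg _) (expJac_nonneg _))]
  congr 1
  change _ = expJac x.1 * expJac x.2.2 * ρ x.2.1
  rw [hvol, svdO]
  change _ * volumeOn g (svdMap (((svdChart U V x).1 : Mat d), x.2.1, _)) _ = _
  ring

/-- Compactness gives finitely many pairs of charts. They are split off one at a time; injectivity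
on `S` keeps the images of disjoint pieces disjoint, so both sides add up. -/
theorem hasSVDVolumeForm_of_pointwise
    (hbil : ∀ (U V : OGroup d) (σ : Fin d → ℝ), IsSingVals σ → ∃ B : LinearMap.BilinForm ℝ (Mat d),
      ∀ X Y, g (svdMap ((U : Mat d), σ, (V : Mat d))) X Y = B X Y)
    (hpt : ∀ (U V : OGroup d) (σ : Fin d → ℝ), IsSingVals σ →
      volumeOn g (svdMap ((U : Mat d), σ, (V : Mat d)))
        (fun a => fderiv ℝ svdMap ((U : Mat d), σ, (V : Mat d)) (svdFrame (U : Mat d) (V : Mat d) a))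
      = ρ σ)
    (hρ : Measurable ρ) : HasSVDVolumeForm g ρ := by
  refine ⟨hpt, fun μ hμ S hS hsing hinj => ?_⟩
  rw [hμ.eq_haarO]
  obtain ⟨t, ht⟩ := exists_finset_expDomain d
  have key : ∀ (t : Finset (OGroup d × OGroup d)) (A : Set (OGroup d × (Fin d → ℝ) × OGroup d)),
      MeasurableSet A → A ⊆ S → (∀ x ∈ A, ∃ p ∈ t, x.1 ∈ expDomain p.1 ∧ x.2.2 ∈ expDomain p.2) →
      volumeMeasure g (svdO '' A)
        = ∫⁻ x in A, ENNReal.ofReal (ρ x.2.1) ∂((haarO d).prod (volume.prod (haarO d))) := by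
    intro t
    induction t using Finset.induction_on with
    | empty =>
      intro A _ _ hcov
      have : A = ∅ := Set.eq_empty_of_forall_notMem fun x hx => by simpa using hcov x hx
      simp [this]
    | insert p t hp ih =>
      intro A hA hAS hcov
      let C : Set (OGroup d × (Fin d → ℝ) × OGroup d) :=
        expDomain p.1 ×ˢ ((Set.univ : Set (Fin d → ℝ)) ×ˢ expDomain p.2)
      have hC : MeasurableSet C := (measurableSet_expDomain _).prod
        (MeasurableSet.univ.prod (measurableSet_expDomain _))
      have h1 := volumeMeasure_image_chart hbil hpt hρ p.1 p.2 (hA.inter hC)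
        (fun x hx => hsing x (hAS hx.1)) (hinj.mono (Set.inter_subset_left.trans hAS))
        Set.inter_subset_right
      have h2 := ih (A \ C) (hA.diff hC) (Set.sdiff_subset.trans hAS) fun x hx => by
        obtain ⟨q, hq, h⟩ := hcov x hx.1
        rcases Finset.mem_insert.mp hq with rfl | hq
        · exact absurd ⟨h.1, Set.mem_univ _, h.2⟩ hx.2
        · exact ⟨q, hq, h⟩
      have hinjA : Set.InjOn svdO A := hinj.mono hAS
      have hdisj : Disjoint (svdO '' (A ∩ C)) (svdO '' (A \ C)) :=
        Set.disjoint_sdiff_inter.symm.image hinjA Set.inter_subset_left Set.sdiff_subset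
      have hm : MeasurableSet (svdO '' (A \ C)) :=
        (hA.diff hC).image_of_continuousOn_injOn (continuous_svdO d).continuousOn
          (hinjA.mono Set.sdiff_subset)
      rw [← Set.inter_union_sdiff A C, Set.image_union, measure_union hdisj hm,
        lintegral_union (hA.diff hC) Set.disjoint_sdiff_inter.symm, h1, h2]
  refine key (t ×ˢ t) S hS subset_rfl fun x _ => ?_
  obtain ⟨U, hU, h1⟩ := ht x.1
  obtain ⟨V, hV, h2⟩ := ht x.2.2
  exact ⟨(U, V), Finset.mk_mem_product hU hV, h1, h2⟩

end

end DLN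
end

/-! ### The densities for finite and infinite depth -/

theorem theorem1 (d : ℕ) :
    (∃ μ : Measure (DLN.OGroup d), DLN.IsHaarO μ) ∧
    (∀ N : ℕ, 1 ≤ N →
      DLN.HasSVDVolumeForm (DLN.metric (d := d) N) fun σ =>
        (N : ℝ) ^ (d * (d - 1) / 2) *
          ((Matrix.diagonal σ ^ 2).det) ^ ((1 - (N : ℝ)) / (2 * (N : ℝ))) *
          DLN.van fun i => σ i ^ (2 / (N : ℝ))) ∧
    DLN.HasSVDVolumeForm (DLN.metricInf (d := d)) fun σ =>
      DLN.van (fun i => Real.log (σ i ^ 2)) / √ (Matrix.diagonal σ ^ 2).det := by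
  have hdet : ∀ σ : Fin d → ℝ, (Matrix.diagonal σ ^ 2).det = ∏ i, σ i ^ 2 := fun σ => by
    rw [Matrix.diagonal_pow, Matrix.det_diagonal]
    rfl
  refine ⟨⟨DLN.haarO d, DLN.isHaarO_haarO d⟩, fun N hN => ?_, ?_⟩
  · refine DLN.hasSVDVolumeForm_of_pointwise (fun U V σ hσ => ?_) (fun U V σ hσ => ?_) ?_
    · exact DLN.exists_bilinForm U.transpose_mul V.transpose_mul
        (Λ := Matrix.of fun i j => DLN.eigN N (σ i) (σ j))
        (fun i j => (DLN.eigN_pos hN (hσ.2 i) (hσ.2 j)).ne')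
        (DLN.opA_svd N U.transpose_mul V.transpose_mul σ)
    · have hN' : (0 : ℝ) < N := by exact_mod_cast hN
      -- Here `f = N σ^(2/N)`, the choice for which `Λ_ij (f_i - f_j) = σ_i² - σ_j²`.
      have hanti : Antitone fun i => (N : ℝ) * σ i ^ (2 / (N : ℝ)) := fun i j hij =>
        mul_le_mul_of_nonneg_left (Real.rpow_le_rpow (hσ.2 j).le (hσ.1 hij) (by positivity)) hN'.le
      rw [DLN.volumeOn_svdFrame (A := DLN.opA N (DLN.svdMap ((U : DLN.Mat d), σ, (V : DLN.Mat d))))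
        U.transpose_mul V.transpose_mul hσ.2 rfl hanti
        (Λ := Matrix.of fun i j => DLN.eigN N (σ i) (σ j))
        (fun i j => DLN.eigN_pos hN (hσ.2 i) (hσ.2 j))
        (fun i j => DLN.eigN_mul_sub hN (hσ.2 i) (hσ.2 j))
        (DLN.opA_svd N U.transpose_mul V.transpose_mul σ), DLN.van_const_mul, hdet]
      have hprod : 0 < ∏ i, σ i ^ 2 := Finset.prod_pos fun i _ => pow_pos (hσ.2 i) 2
      have h1 : ∏ i, (Matrix.of fun i j => DLN.eigN N (σ i) (σ j)) i i
          = (∏ i, σ i ^ 2) ^ (((N : ℝ) - 1) / (N : ℝ)) := by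
        rw [← Real.finsetProd_rpow _ _ fun i _ => sq_nonneg _]
        exact Finset.prod_congr rfl fun i _ => DLN.eigN_self hN (hσ.2 i)
      -- The diagonal eigenvalues `(σ_i²)^((N-1)/N)` produce the power of `det (Σ²)`.
      have h2 : (√ (∏ i, (Matrix.of fun i j => DLN.eigN N (σ i) (σ j)) i i))⁻¹
          = (∏ i, σ i ^ 2) ^ ((1 - (N : ℝ)) / (2 * (N : ℝ))) := by
        rw [h1, Real.sqrt_eq_rpow, ← Real.rpow_mul hprod.le, ← Real.rpow_neg hprod.le]
        congr 1
        field_simp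
        ring
      rw [div_eq_mul_inv, h2]
      ring
    · simp only [hdet, DLN.van]
      fun_prop
  · refine DLN.hasSVDVolumeForm_of_pointwise (fun U V σ hσ => ?_) (fun U V σ hσ => ?_) ?_
    · exact DLN.exists_bilinForm U.transpose_mul V.transpose_mul
        (Λ := Matrix.of fun i j => DLN.eigInf (σ i) (σ j))
        (fun i j => (DLN.eigInf_pos (hσ.2 i) (hσ.2 j)).ne')
        (DLN.opAInf_svd U.transpose_mul V.transpose_mul hσ.2)
    · have hanti : Antitone fun i => Real.log (σ i ^ 2) := fun i j hij =>
        Real.log_le_log (pow_pos (hσ.2 j) 2) (pow_le_pow_left₀ (hσ.2 j).le (hσ.1 hij) 2)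
      rw [DLN.volumeOn_svdFrame (A := DLN.opAInf (DLN.svdMap ((U : DLN.Mat d), σ, (V : DLN.Mat d))))
        U.transpose_mul V.transpose_mul hσ.2 rfl hanti
        (Λ := Matrix.of fun i j => DLN.eigInf (σ i) (σ j))
        (fun i j => DLN.eigInf_pos (hσ.2 i) (hσ.2 j))
        (fun i j => DLN.eigInf_mul_sub (hσ.2 i) (hσ.2 j))
        (DLN.opAInf_svd U.transpose_mul V.transpose_mul hσ.2), hdet]
      congr 2
      exact Finset.prod_congr rfl fun i _ => DLN.eigInf_self (hσ.2 i)
    · simp only [hdet, DLN.van]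
      fun_prop
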